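/- Let $(\Omega,\mathcal F,(\mathcal F_t)_{t\in[0,T]},P)$ be a filtered probability space, $T>0$, and let $S=(S_t)_{t\in[0,T]}$ be an $\mathbb R^d$-valued adapted process with càdlàg paths (for instance, a semimartingale) such that $\sup_{t\le T}|S_t|\in L^1(P)$. Let $\mathcal K$ be the set of terminal gains $K=\sum_{i=1}^{n-1}H_i\cdot(S_{\tau_{i+1}}-S_{\tau_i})$, where $0\le\tau_1\le\dots\le\tau_n\le T$ are stopping times and each $H_i$ is a bounded $\mathcal F_{\tau_i}$-measurable $\mathbb R^d$-valued random variable, and assume that some $K\in\mathcal K$ is not almost surely $0$. For $X\in L^1(P)$ with $P(X\ne0)>0$ put $\alpha(X)=E[X^+]/E[X^-]\in[0,+\infty]$ (with $c/0=+\infty$ for $c>0$), and for $B\in L^1(P)$ let $$\alpha^*(B)=\sup\{\alpha(B+K) : K\in\mathcal K,\ P(B+K\neq 0)>0\}.$$ Let $\mathcal M_\infty$ be the set of probability measures $Q$ equivalent to $P$ under which $S$ is a martingale and whose density $Z=dQ/dP$ is essentially bounded and essentially bounded away from $0$. Then, for every $B\in L^1(P)$, the following conditions are equivalent: (i) $\alpha^*(B)<+\infty$;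 (ii) $E_Q[B]\le 0$ for some $Q\in\mathcal M_\infty$. If these conditions hold, then $$\alpha^*(B)=\min_{Q\in\mathcal M_\infty,\ E_Q[B]\le 0}\ \frac{\operatorname{ess\,sup} Z}{\operatorname{ess\,inf} Z},$$ where the minimum is attained. If moreover $\alpha^*(0)<\alpha^*(B)<+\infty$, then also $$\alpha^*(B)=\min_{Q\in\mathcal M_\infty,\ E_Q[B]= 0}\ \frac{\operatorname{ess\,sup} Z}{\operatorname{ess\,inf} Z},$$ where the minimum is attained. -/

import Mathlib

open MeasureTheory Filter Topology
open scoped ENNReal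

namespace GainLoss

/-- Every path is right-continuous and has left limits at each time of `[0, T]`. -/
def IsCadlag {Ω : Type*} {d : ℕ} {T : ℝ}
    (S : Set.Icc (0 : ℝ) T → Ω → EuclideanSpace ℝ (Fin d)) : Prop :=
  ∀ ω t, ContinuousWithinAt (fun s => S s ω) (Set.Ioi t) t ∧
    ∃ l, Tendsto (fun s => S s ω) (𝓝[<] t) (𝓝 l)

/-- The maximal functional `S*_T = sup_{t ≤ T} |S_t|` is `P`-integrable. -/
def IntegrableMaximal {Ω : Type*} [MeasurableSpace Ω] (P : Measure Ω) {d : ℕ} {T : ℝ}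
    (S : Set.Icc (0 : ℝ) T → Ω → EuclideanSpace ℝ (Fin d)) : Prop :=
  ∫⁻ ω, ⨆ t, ‖S t ω‖ₑ ∂P < ∞

/-- A simple, predictable, bounded strategy `ξ = ∑ i < n, H i • 𝟙_{]τ i, τ (i + 1)]}`: the `τ i` are
ordered `[0, T]`-valued stopping times, and `H i` is bounded and `𝓕_{τ i}`-measurable. -/
structure SimpleStrategy {Ω : Type*} [mΩ : MeasurableSpace Ω] {T : ℝ}
    (𝓕 : Filtration (Set.Icc (0 : ℝ) T) mΩ) (d : ℕ) where
  n : ℕ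
  τ : Fin (n + 1) → Ω → Set.Icc (0 : ℝ) T
  H : Fin n → Ω → EuclideanSpace ℝ (Fin d)
  isStoppingTime : ∀ i, IsStoppingTime 𝓕 (fun ω => (τ i ω : WithTop (Set.Icc (0 : ℝ) T)))
  monotone : ∀ ω, Monotone fun i => τ i ω
  measurable : ∀ i, Measurable[(isStoppingTime i.castSucc).measurableSpace] (H i)
  bounded : ∃ C : ℝ, ∀ i ω, ‖H i ω‖ ≤ C

/-- The terminal gain `(ξ · S)_T = ∑ i, ⟪H i, S_{τ (i + 1)} - S_{τ i}⟫`. -/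
noncomputable def SimpleStrategy.gain {Ω : Type*} [mΩ : MeasurableSpace Ω] {T : ℝ}
    {𝓕 : Filtration (Set.Icc (0 : ℝ) T) mΩ} {d : ℕ} (ξ : SimpleStrategy 𝓕 d)
    (S : Set.Icc (0 : ℝ) T → Ω → EuclideanSpace ℝ (Fin d)) (ω : Ω) : ℝ :=
  ∑ i, inner ℝ (ξ.H i ω) (S (ξ.τ i.succ ω) ω - S (ξ.τ i.castSucc ω) ω)

/-- The set `𝒦` of terminal gains of simple strategies. -/
def gains {Ω : Type*} [mΩ : MeasurableSpace Ω] {T : ℝ}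
    (𝓕 : Filtration (Set.Icc (0 : ℝ) T) mΩ) {d : ℕ}
    (S : Set.Icc (0 : ℝ) T → Ω → EuclideanSpace ℝ (Fin d)) : Set (Ω → ℝ) :=
  {K | ∃ ξ : SimpleStrategy 𝓕 d, K = ξ.gain S}

/-- The gain-loss ratio `α(X) = E[X⁺] / E[X⁻] ∈ [0, ∞]` (used for integrable `X` that do not vanish
almost surely, so that neither `0 / 0` nor `∞ / ∞` occurs; `c / 0 = ∞` for `c > 0`). -/
noncomputable def gainLoss {Ω : Type*} [MeasurableSpace Ω] (P : Measure Ω) (X : Ω → ℝ) : ℝ≥0∞ :=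
  (∫⁻ ω, ENNReal.ofReal (X ω) ∂P) / (∫⁻ ω, ENNReal.ofReal (-X ω) ∂P)

/-- The best gain-loss ratio `α*(B)`: the supremum of `α(B + K)` over the gains `K ∈ 𝒦` for which
`B + K` is not almost surely `0`. -/
noncomputable def bestGainLoss {Ω : Type*} [mΩ : MeasurableSpace Ω] (P : Measure Ω) {T : ℝ}
    (𝓕 : Filtration (Set.Icc (0 : ℝ) T) mΩ) {d : ℕ}
    (S : Set.Icc (0 : ℝ) T → Ω → EuclideanSpace ℝ (Fin d)) (B : Ω → ℝ) : ℝ≥0∞ :=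
  ⨆ K ∈ gains 𝓕 S, ⨆ _ : ¬ (B + K =ᵐ[P] 0), gainLoss P (B + K)

/-- The set `𝓜_∞` of equivalent martingale probabilities for `S` whose density with respect to `P`
is (essentially) bounded and bounded away from `0`. -/
def boundedMartingaleMeasures {Ω : Type*} [mΩ : MeasurableSpace Ω] (P : Measure Ω) {T : ℝ}
    (𝓕 : Filtration (Set.Icc (0 : ℝ) T) mΩ) {d : ℕ}
    (S : Set.Icc (0 : ℝ) T → Ω → EuclideanSpace ℝ (Fin d)) : Set (Measure Ω) :=
  {Q | IsProbabilityMeasure Q ∧ Q ≪ P ∧ P ≪ Q ∧ Martingale S 𝓕 Q ∧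
    essSup (Q.rnDeriv P) P < ∞ ∧ 0 < essInf (Q.rnDeriv P) P}

/-- The ratio `ess sup Z / ess inf Z` of the density `Z = dQ/dP`. -/
noncomputable def densityRatio {Ω : Type*} [MeasurableSpace Ω] (P Q : Measure Ω) : ℝ≥0∞ :=
  essSup (Q.rnDeriv P) P / essInf (Q.rnDeriv P) P

end GainLoss

namespace GainLoss

/-! Since `E[X⁺] = (E|X| + E[X]) / 2` and `E[X⁻] = (E|X| - E[X]) / 2`, the bound `α(X) ≤ a` is the
homogeneous inequality `(a + 1) E[X] ≤ (a - 1) E|X|`. This turns the optimisation over gains into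
the separation of two cones in `L¹`.

Weak duality: if `m ≤ Z ≤ M` and `E_Q[X] ≤ 0`, then `m E[X⁺] ≤ E_Q[X⁺] ≤ E_Q[X⁻] ≤ M E[X⁻]`.
Optional sampling gives `E_Q[K] = 0`, so this applies to `X = B + K` and yields
`bestGainLoss_le_densityRatio`.

Strong duality: let `a = α*(B)` be finite. The convex cone `{s B + K : s ≥ 0}` misses the open
convex cone `(a + 1) E[Y] > (a - 1) E|Y|`. Hahn-Banach gives a functional on `L¹` that is
nonpositive on the first and nonnegative on the closed version of the second. The second contains
the indicators, so the functional is a measure; it also contains the directions `a P(A) 1_C - P(C)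
1_A`, which forces the density to oscillate by a factor at most `a` (`exists_measure_of_cone`).
Gains form a vector space (`add_mem_gains`), so they are annihilated, and buy-and-hold gains make
`S` a martingale. Weak duality then shows that this measure is a minimiser.

For the last claim, the minimiser for `B` is mixed with the one for `0`, which must give `B` a
positive expectation; oscillation bounds survive mixing. -/

/-! ### Telescoping sums along a monotone grid. -/

theorem sum_ite_lt_sub_of_monotone {α E : Type*} [LinearOrder α] [AddCommGroup E] {N : ℕ}
    {ρ : Fin (N + 1) → α} (hρ : Monotone ρ) {b : α} (hb : b ∈ Set.range ρ) (f : α → E) :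
    ∑ k : Fin N, (if ρ k.castSucc < b then f (ρ k.succ) - f (ρ k.castSucc) else 0) =
      f b - f (ρ 0) := by
  obtain ⟨j, rfl⟩ := hb
  -- Each term is an increment of `f` stopped at `ρ j`: as `ρ j` is itself a grid value, it never
  -- falls strictly inside a grid interval.
  have key : ∀ k : Fin N,
      (if ρ k.castSucc < ρ j then f (ρ k.succ) - f (ρ k.castSucc) else 0) =
        f (min (ρ k.succ) (ρ j)) - f (min (ρ k.castSucc) (ρ j)) := by
    intro k
    split_ifs with h
    · have h1 : ρ k.succ ≤ ρ j := by
        refine hρ ?_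
        by_contra hlt
        exact absurd (hρ (Fin.le_castSucc_iff.mpr (not_le.mp hlt))) (not_le.mpr h)
      rw [min_eq_left h1, min_eq_left h.le]
    · have h1 : ρ j ≤ ρ k.castSucc := not_lt.mp h
      rw [min_eq_right h1, min_eq_right (h1.trans (hρ k.castSucc_lt_succ.le)), sub_self]
  have htel : ∀ g : Fin (N + 1) → E,
      ∑ k : Fin N, (g k.succ - g k.castSucc) = g (Fin.last N) - g 0 := by
    intro g
    have h := (Fin.sum_univ_succ g).symm.trans (Fin.sum_univ_castSucc g)
    rw [Finset.sum_sub_distrib, sub_eq_sub_iff_add_eq_add, add_comm, h, add_comm]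
  rw [Finset.sum_congr rfl fun k _ => key k, htel fun k => f (min (ρ k) (ρ j)),
    min_eq_right (hρ (Fin.le_last j)), min_eq_left (hρ (Fin.zero_le j))]

theorem sum_ite_Ico_sub_of_monotone {α E : Type*} [LinearOrder α] [AddCommGroup E] {N : ℕ}
    {ρ : Fin (N + 1) → α} (hρ : Monotone ρ) {a b : α} (ha : a ∈ Set.range ρ)
    (hb : b ∈ Set.range ρ) (hab : a ≤ b) (f : α → E) :
    ∑ k : Fin N, (if a ≤ ρ k.castSucc ∧ ρ k.castSucc < b then
      f (ρ k.succ) - f (ρ k.castSucc) else 0) = f b - f a := by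
  rw [← sub_sub_sub_cancel_right (f b) (f a) (f (ρ 0)), ← sum_ite_lt_sub_of_monotone hρ hb f,
    ← sum_ite_lt_sub_of_monotone hρ ha f, ← Finset.sum_sub_distrib]
  refine Finset.sum_congr rfl fun k _ => ?_
  rcases lt_or_ge (ρ k.castSucc) a with h | h
  · simp [h, not_le.mpr h, h.trans_le hab]
  · simp [h, not_lt.mpr h]

/-! ### Order statistics of stopping times, and the vector space of gains. -/

section

variable {Ω : Type*} {T : ℝ}

/-- The order statistics of a finite family of random times. -/
noncomputable def sortedTime {N : ℕ} (θ : Fin N → Ω → Set.Icc (0 : ℝ) T) (k : Fin N) (ω : Ω) :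
    Set.Icc (0 : ℝ) T :=
  θ (Tuple.sort (fun i => θ i ω) k) ω

theorem sortedTime_monotone {N : ℕ} (θ : Fin N → Ω → Set.Icc (0 : ℝ) T) (ω : Ω) :
    Monotone fun k => sortedTime θ k ω :=
  Tuple.monotone_sort fun i => θ i ω

theorem mem_range_sortedTime {N : ℕ} (θ : Fin N → Ω → Set.Icc (0 : ℝ) T) (ω : Ω) (i : Fin N) :
    θ i ω ∈ Set.range fun k => sortedTime θ k ω :=
  ⟨(Tuple.sort fun i => θ i ω).symm i, by simp [sortedTime]⟩

/-- With indices starting at 0, the condition says that at least `k + 1` of the times are `≤ t`.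
Quantifying over index sets writes the event as a finite union of finite intersections, hence the
stopping time property. -/
theorem sortedTime_le_iff {N : ℕ} (θ : Fin N → Ω → Set.Icc (0 : ℝ) T) (k : Fin N) (ω : Ω)
    (t : Set.Icc (0 : ℝ) T) :
    sortedTime θ k ω ≤ t ↔ ∃ s : Finset (Fin N), (k : ℕ) < s.card ∧ ∀ i ∈ s, θ i ω ≤ t := by
  rw [← Tuple.lt_card_le_iff_apply_le_of_monotone (sortedTime_monotone θ ω)]
  have hcard : (Finset.univ.filter fun i => sortedTime θ i ω ≤ t).card =
      (Finset.univ.filter fun i => θ i ω ≤ t).card := by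
    rw [← Fintype.card_subtype, ← Fintype.card_subtype]
    exact Fintype.card_congr ((Tuple.sort fun i => θ i ω).subtypeEquiv fun i => Iff.rfl)
  rw [hcard]
  constructor
  · intro hk
    exact ⟨_, hk, fun i hi => (Finset.mem_filter.mp hi).2⟩
  · rintro ⟨s, hs, hi⟩
    exact hs.trans_le (Finset.card_le_card fun i his => by simpa using hi i his)

variable [mΩ : MeasurableSpace Ω] {𝓕 : Filtration (Set.Icc (0 : ℝ) T) mΩ}

theorem isStoppingTime_sortedTime {N : ℕ} {θ : Fin N → Ω → Set.Icc (0 : ℝ) T}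
    (hθ : ∀ i, IsStoppingTime 𝓕 (fun ω => (θ i ω : WithTop (Set.Icc (0 : ℝ) T)))) (k : Fin N) :
    IsStoppingTime 𝓕 (fun ω => (sortedTime θ k ω : WithTop (Set.Icc (0 : ℝ) T))) := by
  intro t
  have : {ω | (sortedTime θ k ω : WithTop (Set.Icc (0 : ℝ) T)) ≤ t} =
      ⋃ s ∈ {s : Finset (Fin N) | (k : ℕ) < s.card}, ⋂ i ∈ s,
        {ω | (θ i ω : WithTop (Set.Icc (0 : ℝ) T)) ≤ t} := by
    ext ω
    simp only [Set.mem_ofPred_eq, WithTop.coe_le_coe, sortedTime_le_iff, Set.mem_iUnion,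
      Set.mem_iInter, exists_prop]
  rw [this]
  exact MeasurableSet.biUnion (Set.to_countable _) fun s _ =>
    MeasurableSet.biInter (Set.to_countable _) fun i _ => hθ i t

theorem measurable_indicator_le_of_stoppingTime {E : Type*} [Zero E] [MeasurableSpace E]
    {σ ρ : Ω → WithTop (Set.Icc (0 : ℝ) T)} (hσ : IsStoppingTime 𝓕 σ) (hρ : IsStoppingTime 𝓕 ρ)
    {H : Ω → E} (hH : Measurable[hσ.measurableSpace] H) :
    Measurable[hρ.measurableSpace] ({ω | σ ω ≤ ρ ω}.indicator H) := by
  intro U hU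
  rw [Set.indicator_preimage]
  have hle : MeasurableSet[hρ.measurableSpace] {ω | σ ω ≤ ρ ω} := hσ.measurableSet_stopping_time_le hρ
  have hmin := hσ.measurableSet_inter_le hρ _ (hH hU)
  rw [hσ.measurableSet_min_iff hρ] at hmin
  refine MeasurableSet.union hmin.2 (MeasurableSet.diff ?_ hle)
  exact measurable_const (a := (0 : E)) hU

/-- Positions on overlapping intervals `]θ (a i), θ (b i)]` are rewritten on the common sorted grid:
on each grid interval the holding is the sum of those `H i` whose interval contains it. The position
is known at the left endpoint `ρ`, because restricting an `𝓕_σ`-measurable variable to `{σ ≤ ρ}`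
makes it `𝓕_ρ`-measurable. -/
theorem gain_mem_gains_of_family {d : ℕ} (S : Set.Icc (0 : ℝ) T → Ω → EuclideanSpace ℝ (Fin d))
    {N : ℕ} {θ : Fin (N + 1) → Ω → Set.Icc (0 : ℝ) T}
    (hθ : ∀ i, IsStoppingTime 𝓕 (fun ω => (θ i ω : WithTop (Set.Icc (0 : ℝ) T))))
    {ι : Type*} [Fintype ι] (a b : ι → Fin (N + 1)) (hab : ∀ i ω, θ (a i) ω ≤ θ (b i) ω)
    {H : ι → Ω → EuclideanSpace ℝ (Fin d)}
    (hH : ∀ i, Measurable[(hθ (a i)).measurableSpace] (H i))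
    (hbd : ∃ C : ℝ, ∀ i ω, ‖H i ω‖ ≤ C) :
    (fun ω => ∑ i, inner ℝ (H i ω) (S (θ (b i) ω) ω - S (θ (a i) ω) ω)) ∈ gains 𝓕 S := by
  classical
  obtain ⟨C, hC⟩ := hbd
  refine ⟨{ n := N
            τ := sortedTime θ
            H := fun k ω => ∑ i, if θ (a i) ω ≤ sortedTime θ k.castSucc ω ∧
              sortedTime θ k.castSucc ω < θ (b i) ω then H i ω else 0
            isStoppingTime := isStoppingTime_sortedTime hθ
            monotone := sortedTime_monotone θ
            measurable := ?_
            bounded := ?_ }, ?_⟩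
  · intro k
    refine Finset.measurable_fun_sum _ fun i _ => ?_
    have hρ := isStoppingTime_sortedTime hθ k.castSucc
    have h1 := measurable_indicator_le_of_stoppingTime (hθ (a i)) hρ (hH i)
    have h2 := ((hθ (b i)).measurableSet_stopping_time_le hρ).compl
    convert h1.indicator h2 using 1
    ext1 ω
    simp only [Set.indicator_apply, Set.mem_compl_iff, Set.mem_ofPred_eq, WithTop.coe_le_coe, not_le]
    by_cases h1 : θ (a i) ω ≤ sortedTime θ k.castSucc ω <;>
      by_cases h2 : sortedTime θ k.castSucc ω < θ (b i) ω <;> simp [h1, h2]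
  · refine ⟨∑ _i : ι, |C|, fun k ω => (norm_sum_le _ _).trans (Finset.sum_le_sum fun i _ => ?_)⟩
    split_ifs
    · exact (hC i ω).trans (le_abs_self C)
    · simp
  · ext ω
    simp only [SimpleStrategy.gain, sum_inner]
    rw [Finset.sum_comm]
    refine Finset.sum_congr rfl fun i _ => ?_
    rw [← sum_ite_Ico_sub_of_monotone (sortedTime_monotone θ ω) (mem_range_sortedTime θ ω (a i))
      (mem_range_sortedTime θ ω (b i)) (hab i ω) (fun t => S t ω), inner_sum]
    refine Finset.sum_congr rfl fun k _ => ?_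
    split_ifs <;> simp

theorem measurable_of_stoppingTime_eq {E : Type*} [MeasurableSpace E]
    {σ σ' : Ω → WithTop (Set.Icc (0 : ℝ) T)} (h : σ = σ') (hσ : IsStoppingTime 𝓕 σ)
    (hσ' : IsStoppingTime 𝓕 σ') {H : Ω → E} (hH : Measurable[hσ.measurableSpace] H) :
    Measurable[hσ'.measurableSpace] H := by
  subst h
  exact hH

theorem add_mem_gains {d : ℕ} {S : Set.Icc (0 : ℝ) T → Ω → EuclideanSpace ℝ (Fin d)}
    {K L : Ω → ℝ} (hK : K ∈ gains 𝓕 S) (hL : L ∈ gains 𝓕 S) : K + L ∈ gains 𝓕 S := by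
  obtain ⟨ξ, rfl⟩ := hK
  obtain ⟨η, rfl⟩ := hL
  obtain ⟨C, hC⟩ := ξ.bounded
  obtain ⟨D, hD⟩ := η.bounded
  -- The stopping times of both strategies are pooled into one family, which need not be ordered.
  let e : Fin (ξ.n + 1) ⊕ Fin (η.n + 1) ≃ Fin (ξ.n + 1 + η.n + 1) := finSumFinEquiv
  let θ : Fin (ξ.n + 1 + η.n + 1) → Ω → Set.Icc (0 : ℝ) T := fun i => Sum.elim ξ.τ η.τ (e.symm i)
  have hl : ∀ i, θ (e (Sum.inl i)) = ξ.τ i := fun i => by simp [θ]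
  have hr : ∀ i, θ (e (Sum.inr i)) = η.τ i := fun i => by simp [θ]
  have hθ : ∀ i, IsStoppingTime 𝓕 (fun ω => (θ i ω : WithTop (Set.Icc (0 : ℝ) T))) := by
    intro i
    obtain ⟨j | j, rfl⟩ := e.surjective i
    · simpa only [hl] using ξ.isStoppingTime j
    · simpa only [hr] using η.isStoppingTime j
  have key := gain_mem_gains_of_family S hθ (ι := Fin ξ.n ⊕ Fin η.n)
    (fun i => e (i.map Fin.castSucc Fin.castSucc)) (fun i => e (i.map Fin.succ Fin.succ))
    (H := Sum.elim ξ.H η.H) ?_ ?_ ⟨max C D, ?_⟩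
  · convert key using 1
    ext ω
    simp [SimpleStrategy.gain, hl, hr]
  · rintro (i | i) ω
    · simpa [hl] using ξ.monotone ω i.castSucc_lt_succ.le
    · simpa [hr] using η.monotone ω i.castSucc_lt_succ.le
  · rintro (i | i)
    · exact measurable_of_stoppingTime_eq (by simp [hl]) _ _ (ξ.measurable i)
    · exact measurable_of_stoppingTime_eq (by simp [hr]) _ _ (η.measurable i)
  · rintro (i | i) ω
    · exact (hC i ω).trans (le_max_left _ _)
    · exact (hD i ω).trans (le_max_right _ _)

theorem smul_mem_gains {d : ℕ} {S : Set.Icc (0 : ℝ) T → Ω → EuclideanSpace ℝ (Fin d)}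
    {K : Ω → ℝ} (hK : K ∈ gains 𝓕 S) (c : ℝ) : c • K ∈ gains 𝓕 S := by
  obtain ⟨ξ, rfl⟩ := hK
  obtain ⟨C, hC⟩ := ξ.bounded
  refine ⟨{ ξ with
            H := fun i ω => c • ξ.H i ω
            measurable := fun i => (ξ.measurable i).const_smul c
            bounded := ⟨|c| * C, fun i ω => ?_⟩ }, ?_⟩
  · rw [norm_smul, Real.norm_eq_abs]
    exact mul_le_mul_of_nonneg_left (hC i ω) (abs_nonneg c)
  · ext ω
    simp [SimpleStrategy.gain, inner_smul_left, Finset.mul_sum]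

/-- The terminal gain of holding `H` on `]σ, τ]`. -/
theorem inner_sub_mem_gains {d : ℕ} (S : Set.Icc (0 : ℝ) T → Ω → EuclideanSpace ℝ (Fin d))
    {σ τ : Ω → Set.Icc (0 : ℝ) T}
    (hσ : IsStoppingTime 𝓕 (fun ω => (σ ω : WithTop (Set.Icc (0 : ℝ) T))))
    (hτ : IsStoppingTime 𝓕 (fun ω => (τ ω : WithTop (Set.Icc (0 : ℝ) T)))) (hle : σ ≤ τ)
    {H : Ω → EuclideanSpace ℝ (Fin d)} (hH : Measurable[hσ.measurableSpace] H)
    {C : ℝ} (hC : ∀ ω, ‖H ω‖ ≤ C) :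
    (fun ω => inner ℝ (H ω) (S (τ ω) ω - S (σ ω) ω)) ∈ gains 𝓕 S := by
  refine ⟨{ n := 1
            τ := ![σ, τ]
            H := fun _ => H
            isStoppingTime := Fin.forall_fin_two.mpr ⟨hσ, hτ⟩
            monotone := fun ω => Fin.monotone_iff_le_succ.mpr fun i => ?_
            measurable := fun i => ?_
            bounded := ⟨C, fun _ => hC⟩ }, ?_⟩
  · fin_cases i; exact hle ω
  · fin_cases i; exact hH
  · ext ω
    simp [SimpleStrategy.gain]

end

/-! ### Approximation of times from the right by finite grids. -/

section

variable {T : ℝ}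

/-- The point `T k / (n + 1)`, capped at `T`. -/
noncomputable def gridTime (hT : 0 < T) (n k : ℕ) : Set.Icc (0 : ℝ) T :=
  ⟨min T (T * k / (n + 1)), le_min hT.le (by positivity), min_le_left _ _⟩

/-- The index of the first point of the `n`-th grid that is not before `t`. -/
noncomputable def gridIndex (n : ℕ) (t : Set.Icc (0 : ℝ) T) : ℕ := ⌈((n : ℝ) + 1) * t / T⌉₊

/-- This is the adjunction between ceiling and inclusion; the cap at `T` is harmless because `t ≤
T`. It makes a stopping time rounded up to the grid observable at grid times. -/
theorem gridIndex_le_iff (hT : 0 < T) (n k : ℕ) (t : Set.Icc (0 : ℝ) T) :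
    gridIndex n t ≤ k ↔ t ≤ gridTime hT n k := by
  rw [gridIndex, Nat.ceil_le, ← Subtype.coe_le_coe, gridTime, le_min_iff, and_iff_right t.2.2,
    div_le_iff₀ hT, le_div_iff₀ (by positivity), mul_comm, mul_comm (k : ℝ)]

theorem gridIndex_le (hT : 0 < T) (n : ℕ) (t : Set.Icc (0 : ℝ) T) : gridIndex n t ≤ n + 1 := by
  rw [gridIndex_le_iff hT, ← Subtype.coe_le_coe, gridTime]
  refine le_min t.2.2 ?_
  push_cast
  rw [mul_div_assoc, div_self (by positivity), mul_one]
  exact t.2.2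

theorem tendsto_gridTime_gridIndex (hT : 0 < T) (t : Set.Icc (0 : ℝ) T) :
    Tendsto (fun n => gridTime hT n (gridIndex n t)) atTop (𝓝[≥] t) := by
  refine tendsto_nhdsWithin_iff.mpr ⟨?_, .of_forall fun n => (gridIndex_le_iff hT n _ t).mp le_rfl⟩
  rw [tendsto_subtype_rng]
  have h : Tendsto (fun n : ℕ => (t : ℝ) + T * (1 / ((n : ℝ) + 1))) atTop (𝓝 t) := by
    simpa using (tendsto_one_div_add_atTop_nhds_zero_nat.const_mul T).const_add (t : ℝ)
  refine tendsto_of_tendsto_of_tendsto_of_le_of_le tendsto_const_nhds h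
    (fun n => Subtype.coe_le_coe.mpr ((gridIndex_le_iff hT n _ t).mp le_rfl)) fun n => ?_
  refine (min_le_right _ _).trans ?_
  have hpos : (0 : ℝ) < n + 1 := by positivity
  have hk : (gridIndex n t : ℝ) ≤ ((n : ℝ) + 1) * t / T + 1 :=
    (Nat.ceil_lt_add_one (div_nonneg (mul_nonneg hpos.le t.2.1) hT.le)).le
  calc T * (gridIndex n t : ℝ) / (n + 1) ≤ T * (((n : ℝ) + 1) * t / T + 1) / (n + 1) := by gcongr
    _ = t + T * (1 / ((n : ℝ) + 1)) := by field_simp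

end

/-! ### Optional sampling for simple strategies, and its converse. -/

section

variable {Ω : Type*} {T : ℝ} {d : ℕ} {S : Set.Icc (0 : ℝ) T → Ω → EuclideanSpace ℝ (Fin d)}

theorem IsCadlag.tendsto_gridTime (hS : IsCadlag S) (hT : 0 < T) (ω : Ω) (t : Set.Icc (0 : ℝ) T) :
    Tendsto (fun n => S (gridTime hT n (gridIndex n t)) ω) atTop (𝓝 (S t ω)) :=
  (continuousWithinAt_Ioi_iff_Ici.mp (hS ω t).1).tendsto.comp (tendsto_gridTime_gridIndex hT t)

variable [mΩ : MeasurableSpace Ω] {𝓕 : Filtration (Set.Icc (0 : ℝ) T) mΩ}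
  {σ : Ω → Set.Icc (0 : ℝ) T}

theorem measurableSet_gridIndex_eq (hT : 0 < T)
    (hσ : IsStoppingTime 𝓕 (fun ω => (σ ω : WithTop (Set.Icc (0 : ℝ) T)))) (n k : ℕ) :
    MeasurableSet[𝓕 (gridTime hT n k)] {ω | gridIndex n (σ ω) = k} := by
  have hle : ∀ j, {ω | gridIndex n (σ ω) ≤ j} =
      {ω | (σ ω : WithTop (Set.Icc (0 : ℝ) T)) ≤ gridTime hT n j} := fun j => by
    ext ω
    simp only [Set.mem_ofPred_eq, gridIndex_le_iff hT, WithTop.coe_le_coe]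
  have hm : ∀ j, MeasurableSet[𝓕 (gridTime hT n j)] {ω | gridIndex n (σ ω) ≤ j} := fun j => by
    rw [hle]
    exact hσ _
  rcases k with _ | k
  · simpa using hm 0
  · have hmono : gridTime hT n k ≤ gridTime hT n (k + 1) := by
      rw [← Subtype.coe_le_coe]
      simp only [gridTime]
      gcongr
      simp
    have : {ω | gridIndex n (σ ω) = k + 1} =
        {ω | gridIndex n (σ ω) ≤ k + 1} \ {ω | gridIndex n (σ ω) ≤ k} := by
      ext ω
      simp only [Set.mem_ofPred_eq, Set.mem_sdiff]
      omega
    rw [this]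
    exact (hm _).diff (𝓕.mono hmono _ (hm k))

theorem stronglyMeasurable_gridTime (hT : 0 < T) (hS : StronglyAdapted 𝓕 S)
    (hσ : IsStoppingTime 𝓕 (fun ω => (σ ω : WithTop (Set.Icc (0 : ℝ) T)))) (n : ℕ) :
    StronglyMeasurable fun ω => S (gridTime hT n (gridIndex n (σ ω))) ω := by
  have : (fun ω => S (gridTime hT n (gridIndex n (σ ω))) ω) = fun ω =>
      ∑ k ∈ Finset.range (n + 2), {ω | gridIndex n (σ ω) = k}.indicator (S (gridTime hT n k)) ω := by
    ext1 ω
    simp only [Set.indicator_apply, Set.mem_ofPred_eq]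
    rw [Finset.sum_ite_eq, if_pos]
    exact Finset.mem_range.mpr (Nat.lt_succ_of_le (gridIndex_le hT n _))
  rw [this]
  exact Finset.stronglyMeasurable_fun_sum _ fun k _ => ((hS _).mono (𝓕.le _)).indicator
    (𝓕.le _ _ (measurableSet_gridIndex_eq hT hσ n k))

theorem stronglyMeasurable_stopped (hT : 0 < T) (hS : StronglyAdapted 𝓕 S) (hc : IsCadlag S)
    (hσ : IsStoppingTime 𝓕 (fun ω => (σ ω : WithTop (Set.Icc (0 : ℝ) T)))) :
    StronglyMeasurable fun ω => S (σ ω) ω :=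
  stronglyMeasurable_of_tendsto atTop (stronglyMeasurable_gridTime hT hS hσ)
    (tendsto_pi_nhds.mpr fun ω => hc.tendsto_gridTime hT ω (σ ω))

variable {Q : Measure Ω}

theorem IntegrableMaximal.integrable (hQ : IntegrableMaximal Q S) {σ : Ω → Set.Icc (0 : ℝ) T}
    (hm : StronglyMeasurable fun ω => S (σ ω) ω) : Integrable (fun ω => S (σ ω) ω) Q :=
  ⟨hm.aestronglyMeasurable,
    (lintegral_mono fun ω => le_iSup (fun t => ‖S t ω‖ₑ) (σ ω)).trans_lt hQ⟩

theorem IntegrableMaximal.of_le_smul {P : Measure Ω} (hP : IntegrableMaximal P S) {c : ℝ≥0∞}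
    (hc : c ≠ ∞) (hQ : Q ≤ c • P) : IntegrableMaximal Q S := by
  refine (lintegral_mono' hQ le_rfl).trans_lt ?_
  rw [lintegral_smul_measure]
  exact ENNReal.mul_lt_top hc.lt_top hP

theorem integrable_inner_of_bounded {G X : Ω → EuclideanSpace ℝ (Fin d)}
    (hG : Measurable G) {C : ℝ} (hC : ∀ ω, ‖G ω‖ ≤ C) (hX : Integrable X Q) :
    Integrable (fun ω => inner ℝ (G ω) (X ω)) Q := by
  refine (hX.norm.const_mul C).mono' (hG.aestronglyMeasurable.inner hX.1) (.of_forall fun ω => ?_)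
  exact (norm_inner_le_norm _ _).trans (mul_le_mul_of_nonneg_right (hC ω) (norm_nonneg _))

theorem integrable_inner_sub_of_bounded {G X Y : Ω → EuclideanSpace ℝ (Fin d)}
    (hG : Measurable G) {C : ℝ} (hC : ∀ ω, ‖G ω‖ ≤ C) (hX : Integrable X Q)
    (hY : Integrable Y Q) : Integrable (fun ω => inner ℝ (G ω) (X ω - Y ω)) Q :=
  integrable_inner_of_bounded hG hC (hX.sub hY)

theorem gain_integrable (hT : 0 < T) (hS : StronglyAdapted 𝓕 S) (hc : IsCadlag S)
    (hQ : IntegrableMaximal Q S) {K : Ω → ℝ} (hK : K ∈ gains 𝓕 S) : Integrable K Q := by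
  obtain ⟨ξ, rfl⟩ := hK
  obtain ⟨C, hC⟩ := ξ.bounded
  refine integrable_finsetSum _ fun i _ => integrable_inner_of_bounded
    ((ξ.measurable i).mono (IsStoppingTime.measurableSpace_le _) le_rfl) (hC i) ?_
  exact (hQ.integrable (stronglyMeasurable_stopped hT hS hc (ξ.isStoppingTime _))).sub
    (hQ.integrable (stronglyMeasurable_stopped hT hS hc (ξ.isStoppingTime _)))

variable [IsFiniteMeasure Q]

theorem integral_inner_sub_of_martingale (hM : Martingale S 𝓕 Q) {v u : Set.Icc (0 : ℝ) T}
    (hvu : v ≤ u) {G : Ω → EuclideanSpace ℝ (Fin d)} (hG : Measurable[𝓕 v] G) {C : ℝ}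
    (hC : ∀ ω, ‖G ω‖ ≤ C) : ∫ ω, inner ℝ (G ω) (S u ω - S v ω) ∂Q = 0 := by
  have hG' : Measurable G := hG.mono (𝓕.le v) le_rfl
  have hu := integrable_inner_of_bounded hG' hC (hM.integrable u)
  have hv := integrable_inner_of_bounded hG' hC (hM.integrable v)
  simp_rw [inner_sub_right]
  rw [integral_sub hu hv, sub_eq_zero, ← integral_condExp (𝓕.le v)]
  refine integral_congr_ae ?_
  have h := condExp_bilin_of_stronglyMeasurable_left (innerSL ℝ) (μ := Q) (m := 𝓕 v)
    hG.stronglyMeasurable (g := S u) hu (hM.integrable u)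
  filter_upwards [h, hM.2 v u hvu] with ω h1 h2
  rw [h2] at h1
  exact h1

/-- For `σ` rounded up to a grid, the expectation splits over the finitely many grid values, where
the martingale property applies. Refining the grid, right-continuity gives pointwise convergence and
the maximal functional gives domination. -/
theorem integral_inner_terminal_sub_stopped (hT : 0 < T) (hc : IsCadlag S)
    (hQ : IntegrableMaximal Q S) (hM : Martingale S 𝓕 Q)
    (hσ : IsStoppingTime 𝓕 (fun ω => (σ ω : WithTop (Set.Icc (0 : ℝ) T))))
    {H : Ω → EuclideanSpace ℝ (Fin d)} (hH : Measurable[hσ.measurableSpace] H) {C : ℝ}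
    (hC : ∀ ω, ‖H ω‖ ≤ C) :
    ∫ ω, inner ℝ (H ω) (S ⟨T, hT.le, le_rfl⟩ ω - S (σ ω) ω) ∂Q = 0 := by
  set u : Set.Icc (0 : ℝ) T := ⟨T, hT.le, le_rfl⟩
  have hH' : Measurable H := hH.mono (IsStoppingTime.measurableSpace_le _) le_rfl
  have hsm := stronglyMeasurable_gridTime hT hM.1 hσ
  have hgrid : ∀ n, ∫ ω, inner ℝ (H ω) (S u ω - S (gridTime hT n (gridIndex n (σ ω))) ω) ∂Q = 0 := by
    intro n
    have hsum : (fun ω => inner ℝ (H ω) (S u ω - S (gridTime hT n (gridIndex n (σ ω))) ω)) =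
        fun ω => ∑ k ∈ Finset.range (n + 2), inner ℝ ({ω | gridIndex n (σ ω) = k}.indicator H ω)
          (S u ω - S (gridTime hT n k) ω) := by
      ext1 ω
      rw [Finset.sum_eq_single_of_mem (gridIndex n (σ ω))
        (Finset.mem_range.mpr (Nat.lt_succ_of_le (gridIndex_le hT n _)))]
      · simp
      · intro k _ hk
        simp [Ne.symm hk]
    have hmeas : ∀ k, Measurable[𝓕 (gridTime hT n k)] ({ω | gridIndex n (σ ω) = k}.indicator H) := by
      intro k
      -- `H` is only `𝓕_σ`-measurable, but `σ` is at most the `k`-th grid time on the event that the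
      -- index is `k`.
      have hmk := measurable_indicator_le_of_stoppingTime hσ
        (isStoppingTime_const 𝓕 (gridTime hT n k)) hH
      rw [IsStoppingTime.measurableSpace_const] at hmk
      convert hmk.indicator (measurableSet_gridIndex_eq hT hσ n k) using 1
      rw [Set.indicator_indicator, Set.inter_eq_left.mpr]
      intro ω hω
      exact WithTop.coe_le_coe.mpr ((gridIndex_le_iff hT n k _).mp (le_of_eq hω))
    have hbd : ∀ k ω, ‖{ω | gridIndex n (σ ω) = k}.indicator H ω‖ ≤ C := fun k ω =>
      (norm_indicator_le_norm_self H ω).trans (hC ω)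
    rw [hsum, integral_finsetSum _ fun k _ => integrable_inner_sub_of_bounded
      ((hmeas k).mono (𝓕.le _) le_rfl) (hbd k) (hM.integrable _) (hM.integrable _)]
    exact Finset.sum_eq_zero fun k _ =>
      integral_inner_sub_of_martingale hM (Subtype.coe_le_coe.mp (gridTime hT n k).2.2) (hmeas k)
        (hbd k)
  -- A countable supremum is measurable, unlike possibly the supremum over all times, which still
  -- bounds its integral.
  let M : Ω → ℝ≥0∞ := fun ω => ⨆ n, ‖S (gridTime hT n (gridIndex n (σ ω))) ω‖ₑ
  have hMm : Measurable M := Measurable.iSup fun n => (hsm n).enorm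
  have hMint : ∫⁻ ω, M ω ∂Q < ∞ :=
    (lintegral_mono fun ω => iSup_le fun n => le_iSup (fun t => ‖S t ω‖ₑ) _).trans_lt hQ
  have hlim := tendsto_integral_of_dominated_convergence (μ := Q)
    (F := fun n ω => inner ℝ (H ω) (S u ω - S (gridTime hT n (gridIndex n (σ ω))) ω))
    (f := fun ω => inner ℝ (H ω) (S u ω - S (σ ω) ω))
    (fun ω => C * (‖S u ω‖ + (M ω).toReal))
    (fun n => hH'.aestronglyMeasurable.inner
      ((hM.integrable u).1.sub (hsm n).aestronglyMeasurable))
    (((hM.integrable u).norm.add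
      (integrable_toReal_of_lintegral_ne_top hMm.aemeasurable hMint.ne)).const_mul C)
    (fun n => by
      filter_upwards [ae_lt_top hMm hMint.ne] with ω hω
      refine (norm_inner_le_norm _ _).trans (mul_le_mul (hC ω) ((norm_sub_le _ _).trans ?_)
        (norm_nonneg _) ((norm_nonneg _).trans (hC ω)))
      gcongr
      rw [← toReal_enorm]
      exact ENNReal.toReal_mono hω.ne
        (le_iSup (fun n => ‖S (gridTime hT n (gridIndex n (σ ω))) ω‖ₑ) n))
    (.of_forall fun ω => (tendsto_const_nhds).inner
      ((tendsto_const_nhds).sub (hc.tendsto_gridTime hT ω (σ ω))))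
  simp only [hgrid] at hlim
  exact tendsto_nhds_unique hlim tendsto_const_nhds

/-- **Optional sampling**: gains of simple strategies have zero expectation under a measure for
which the price process is a martingale with integrable maximal functional. -/
theorem integral_gain_of_martingale (hT : 0 < T) (hc : IsCadlag S)
    (hQ : IntegrableMaximal Q S) (hM : Martingale S 𝓕 Q) {K : Ω → ℝ} (hK : K ∈ gains 𝓕 S) :
    ∫ ω, K ω ∂Q = 0 := by
  obtain ⟨ξ, rfl⟩ := hK
  obtain ⟨C, hC⟩ := ξ.bounded
  have hHm : ∀ i, Measurable (ξ.H i) := fun i =>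
    (ξ.measurable i).mono (IsStoppingTime.measurableSpace_le _) le_rfl
  have hint : ∀ i, Integrable (fun ω => S (ξ.τ i ω) ω) Q := fun i =>
    hQ.integrable (stronglyMeasurable_stopped hT hM.1 hc (ξ.isStoppingTime i))
  simp only [SimpleStrategy.gain]
  rw [integral_finsetSum _ fun i _ => integrable_inner_sub_of_bounded (hHm i) (hC i)
    (hint i.succ) (hint i.castSucc)]
  refine Finset.sum_eq_zero fun i _ => ?_
  have hle : (ξ.isStoppingTime i.castSucc).measurableSpace ≤
      (ξ.isStoppingTime i.succ).measurableSpace :=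
    IsStoppingTime.measurableSpace_mono _ _ fun ω =>
      WithTop.coe_le_coe.mpr (ξ.monotone ω i.castSucc_lt_succ.le)
  have h1 := integral_inner_terminal_sub_stopped hT hc hQ hM (ξ.isStoppingTime i.castSucc)
    (ξ.measurable i) (hC i)
  have h2 := integral_inner_terminal_sub_stopped hT hc hQ hM (ξ.isStoppingTime i.succ)
    ((ξ.measurable i).mono hle le_rfl) (hC i)
  -- The increment is `(S_T - S_σ) - (S_T - S_τ)`, and `H` is also known at the later time `τ`.
  have h3 := integral_sub
    (integrable_inner_sub_of_bounded (hHm i) (hC i) (hM.integrable ⟨T, hT.le, le_rfl⟩)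
      (hint i.castSucc))
    (integrable_inner_sub_of_bounded (hHm i) (hC i) (hM.integrable ⟨T, hT.le, le_rfl⟩)
      (hint i.succ))
  rw [h1, h2, sub_zero] at h3
  rw [← h3]
  refine integral_congr_ae (.of_forall fun ω => ?_)
  simp only [inner_sub_right]
  ring

/-- Buying `c 1_A` at `s` and selling at `t` shows that `∫_A (S_t - S_s)` is orthogonal to every
vector `c`, in particular to itself. -/
theorem martingale_of_integral_gain_eq_zero (hS : StronglyAdapted 𝓕 S)
    (hint : ∀ t, Integrable (S t) Q) (h : ∀ K ∈ gains 𝓕 S, ∫ ω, K ω ∂Q = 0) :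
    Martingale S 𝓕 Q := by
  refine ⟨hS, fun s t hst => (ae_eq_condExp_of_forall_setIntegral_eq (𝓕.le s) (hint t)
    (fun A _ _ => (hint s).integrableOn) (fun A hA _ => ?_) (hS s).aestronglyMeasurable).symm⟩
  have hA' : MeasurableSet A := 𝓕.le s A hA
  have key : ∀ c : EuclideanSpace ℝ (Fin d), inner ℝ c (∫ ω in A, (S t ω - S s ω) ∂Q) = 0 := by
    intro c
    rw [← integral_inner (f := fun ω => S t ω - S s ω) ((hint t).sub (hint s)).integrableOn,
      ← integral_indicator hA']
    have hm : Measurable[(isStoppingTime_const 𝓕 s).measurableSpace] (A.indicator fun _ => c) := by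
      rw [IsStoppingTime.measurableSpace_const]
      exact measurable_const.indicator hA
    have h0 := h _ (inner_sub_mem_gains S (isStoppingTime_const 𝓕 s) (isStoppingTime_const 𝓕 t)
      (fun _ => hst) hm (C := ‖c‖) fun ω => norm_indicator_le_norm_self _ _)
    rw [← h0]
    refine integral_congr_ae (.of_forall fun ω => ?_)
    by_cases hω : ω ∈ A <;> simp [hω]
  have hzero := key (∫ ω in A, (S t ω - S s ω) ∂Q)
  rw [inner_self_eq_zero, integral_sub (hint t).integrableOn (hint s).integrableOn,
    sub_eq_zero] at hzero
  exact hzero.symm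

end

/-! ### Positive functionals on `L¹` are measures. -/

section

variable {Ω : Type*} [MeasurableSpace Ω] {P : Measure Ω} [IsFiniteMeasure P]

/-- A functional on `L¹` of a finite measure, restricted to `L²`, has a density on indicators. -/
theorem exists_integrable_density_of_functional (f : (Ω →₁[P] ℝ) →L[ℝ] ℝ) :
    ∃ g : Ω → ℝ, Integrable g P ∧ ∀ A (hA : MeasurableSet A),
      f (indicatorConstLp 1 hA (measure_ne_top P A) 1) = ∫ ω in A, g ω ∂P := by
  let ι : Lp ℝ 2 P →ₗ[ℝ] Lp ℝ 1 P :=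
    { toFun := fun X => ⟨X.1, Lp.antitone one_le_two X.2⟩
      map_add' := fun X Y => rfl
      map_smul' := fun c X => rfl }
  have hι : ∀ X, ‖ι X‖ ≤ (P Set.univ ^ (1 / 2 : ℝ)).toReal * ‖X‖ := by
    intro X
    have h := eLpNorm_le_eLpNorm_mul_rpow_measure_univ (μ := P) (p := 1) (q := 2) one_le_two
      (Lp.aestronglyMeasurable X)
    have h2 : (1 / (1 : ℝ≥0∞).toReal - 1 / (2 : ℝ≥0∞).toReal) = (1 / 2 : ℝ) := by norm_num
    rw [h2] at h
    rw [Lp.norm_def, Lp.norm_def, ← ENNReal.toReal_mul, mul_comm]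
    exact ENNReal.toReal_mono (ENNReal.mul_ne_top (Lp.eLpNorm_ne_top X)
      (ENNReal.rpow_ne_top_of_nonneg (by norm_num) (measure_ne_top _ _))) h
  -- As `P` is finite, `L²` embeds continuously in `L¹`, so the Hilbert space representation
  -- supplies a density.
  let F : Lp ℝ 2 P →L[ℝ] ℝ := f.comp (ι.mkContinuous _ hι)
  let g : Lp ℝ 2 P := (InnerProductSpace.toDual ℝ _).symm F
  refine ⟨g, (Lp.memLp g).integrable one_le_two, fun A hA => ?_⟩
  have h1 : inner ℝ g (indicatorConstLp 2 hA (measure_ne_top P A) 1) =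
      F (indicatorConstLp 2 hA (measure_ne_top P A) 1) := by
    simp [g]
  rw [real_inner_comm, L2.inner_indicatorConstLp_one] at h1
  rw [h1]
  rfl

/-- The bound `ν ≤ c P` makes integration against `ν` continuous on `L¹`, so agreement on indicators
extends by linearity and density. -/
theorem functional_eq_integral_of_indicator {ν : Measure Ω} [IsFiniteMeasure ν] {c : ℝ}
    (hc : 0 ≤ c) (hν : ν ≤ ENNReal.ofReal c • P) (f : (Ω →₁[P] ℝ) →L[ℝ] ℝ)
    (hf : ∀ A (hA : MeasurableSet A),
      f (indicatorConstLp 1 hA (measure_ne_top P A) 1) = ν.real A)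
    {X : Ω → ℝ} (hX : Integrable X P) : f (hX.toL1 X) = ∫ ω, X ω ∂ν := by
  have hint : ∀ {Y : Ω → ℝ}, Integrable Y P → Integrable Y ν := fun hY =>
    (hY.smul_measure ENNReal.ofReal_ne_top).mono_measure hν
  have hac : ν ≪ P := (Measure.absolutelyContinuous_of_le hν).trans Measure.smul_absolutelyContinuous
  suffices h : ∀ hX : Integrable X P, f (hX.toL1 X) = ∫ ω, X ω ∂ν from h hX
  refine hX.induction (P := fun X => ∀ hX : Integrable X P, f (hX.toL1 X) = ∫ ω, X ω ∂ν)
    ?_ ?_ ?_ ?_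
  · intro b A hA _ hX
    have : hX.toL1 _ = b • indicatorConstLp 1 hA (measure_ne_top P A) (1 : ℝ) := by
      ext1
      filter_upwards [hX.coeFn_toL1, Lp.coeFn_smul b
        (indicatorConstLp 1 hA (measure_ne_top P A) (1 : ℝ)),
        indicatorConstLp_coeFn (p := 1) (hs := hA) (hμs := measure_ne_top P A) (c := (1 : ℝ))]
        with ω h1 h2 h3
      rw [h1, h2, Pi.smul_apply, h3]
      by_cases hω : ω ∈ A <;> simp [hω]
    rw [this, map_smul, hf A hA, integral_indicator_const _ hA, smul_eq_mul, smul_eq_mul, mul_comm]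
  · intro Y Z _ hY hZ ihY ihZ h
    rw [Integrable.toL1_add Y Z hY hZ, map_add, ihY, ihZ, ← integral_add (hint hY) (hint hZ)]
    rfl
  · have hlip : LipschitzWith c.toNNReal fun Y : Ω →₁[P] ℝ => ∫ ω, Y ω ∂ν := by
      refine LipschitzWith.of_dist_le_mul fun Y Z => ?_
      have hY := L1.integrable_coeFn Y
      have hZ := L1.integrable_coeFn Z
      rw [Real.dist_eq, ← Real.norm_eq_abs, ← integral_sub (hint hY) (hint hZ), dist_eq_norm,
        L1.norm_eq_integral_norm, Real.coe_toNNReal c hc]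
      have h1 : ∫ ω, ‖(Y - Z : Ω →₁[P] ℝ) ω‖ ∂P = ∫ ω, ‖Y ω - Z ω‖ ∂P := by
        refine integral_congr_ae ?_
        filter_upwards [Lp.coeFn_sub Y Z] with ω hω
        rw [hω, Pi.sub_apply]
      rw [h1]
      calc ‖∫ ω, (Y ω - Z ω) ∂ν‖ ≤ ∫ ω, ‖Y ω - Z ω‖ ∂ν := norm_integral_le_integral_norm _
        _ ≤ ∫ ω, ‖Y ω - Z ω‖ ∂(ENNReal.ofReal c • P) :=
          integral_mono_measure hν (.of_forall fun _ => norm_nonneg _)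
            ((hY.sub hZ).norm.smul_measure ENNReal.ofReal_ne_top)
        _ = c * ∫ ω, ‖Y ω - Z ω‖ ∂P := by
          rw [integral_smul_measure, ENNReal.toReal_ofReal hc, smul_eq_mul]
    have : {Y : Ω →₁[P] ℝ | ∀ hY : Integrable Y P, f (hY.toL1 Y) = ∫ ω, Y ω ∂ν} =
        {Y | f Y = ∫ ω, Y ω ∂ν} := by
      ext Y
      simp only [Set.mem_ofPred_eq, Integrable.toL1_coeFn]
      exact ⟨fun h => h (L1.integrable_coeFn Y), fun h _ => h⟩
    rw [this]
    exact isClosed_eq f.continuous hlip.continuous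
  · intro Y Z hYZ hY ih hZ
    rw [← integral_congr_ae (hac.ae_le hYZ), ← ih hY]
    congr 1
    exact (Integrable.toL1_eq_toL1_iff _ _ _ _).mpr hYZ.symm

/-- **Riesz representation** of positive functionals on `L¹` of a finite measure. -/
theorem exists_measure_of_positive_functional (f : (Ω →₁[P] ℝ) →L[ℝ] ℝ)
    (hpos : ∀ A (hA : MeasurableSet A), 0 ≤ f (indicatorConstLp 1 hA (measure_ne_top P A) 1)) :
    ∃ ν : Measure Ω, IsFiniteMeasure ν ∧ (∀ A (hA : MeasurableSet A),
      f (indicatorConstLp 1 hA (measure_ne_top P A) 1) = ν.real A) ∧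
      ∀ X (hX : Integrable X P), f (hX.toL1 X) = ∫ ω, X ω ∂ν := by
  obtain ⟨g, hg, hfg⟩ := exists_integrable_density_of_functional f
  have hg0 : 0 ≤ᵐ[P] g := ae_nonneg_of_forall_setIntegral_nonneg hg fun A hA _ =>
    (hpos A hA).trans_eq (hfg A hA)
  let ν := P.withDensity fun ω => ENNReal.ofReal (g ω)
  have hνfin : IsFiniteMeasure ν := isFiniteMeasure_withDensity_ofReal hg.2
  have hνA : ∀ A (hA : MeasurableSet A),
      ν A = ENNReal.ofReal (f (indicatorConstLp 1 hA (measure_ne_top P A) 1)) := fun A hA => by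
    rw [withDensity_apply _ hA, hfg A hA, ofReal_integral_eq_lintegral_ofReal hg.integrableOn
      (ae_restrict_of_ae hg0)]
  have hreal : ∀ A (hA : MeasurableSet A),
      f (indicatorConstLp 1 hA (measure_ne_top P A) 1) = ν.real A := fun A hA => by
    rw [measureReal_def, hνA A hA, ENNReal.toReal_ofReal (hpos A hA)]
  have hle : ν ≤ ENNReal.ofReal ‖f‖ • P := by
    refine Measure.le_iff.mpr fun A hA => ?_
    rw [hνA A hA, Measure.smul_apply, smul_eq_mul, ← ofReal_measureReal,
      ← ENNReal.ofReal_mul (norm_nonneg _)]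
    refine ENNReal.ofReal_le_ofReal ((le_abs_self _).trans ((f.le_opNorm _).trans_eq ?_))
    rw [norm_indicatorConstLp one_ne_zero ENNReal.one_ne_top]
    simp
  exact ⟨ν, hνfin, hreal, fun X hX =>
    functional_eq_integral_of_indicator (norm_nonneg f) hle f hreal hX⟩

end

/-! ### Separation of cones in `L¹`. -/

section

variable {Ω : Type*} [MeasurableSpace Ω] {P : Measure Ω} [IsProbabilityMeasure P]

/-- A convex cone of integrable functions that does not meet the cone
`{Y | (a + 1) E[Y] > (a - 1) E|Y|}` is separated from it by a functional on `L¹`. -/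
theorem exists_functional_of_cone {a : ℝ} (ha : 1 ≤ a) {G : Set (Ω → ℝ)}
    (hG0 : 0 ∈ G) (hGadd : ∀ X ∈ G, ∀ Y ∈ G, X + Y ∈ G)
    (hGsmul : ∀ c : ℝ, 0 ≤ c → ∀ X ∈ G, c • X ∈ G)
    (hG : ∀ X ∈ G, (a + 1) * ∫ ω, X ω ∂P ≤ (a - 1) * ∫ ω, |X ω| ∂P) :
    ∃ f : (Ω →₁[P] ℝ) →L[ℝ] ℝ, 0 < f (indicatorConstLp 1 .univ (measure_ne_top P _) 1) ∧
      (∀ Y : Ω →₁[P] ℝ, (a - 1) * ‖Y‖ ≤ (a + 1) * L1.integral Y → 0 ≤ f Y) ∧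
      ∀ X (hX : Integrable X P), X ∈ G → f (hX.toL1 X) ≤ 0 := by
  let U : Set (Ω →₁[P] ℝ) := {Y | (a - 1) * ‖Y‖ < (a + 1) * L1.integralCLM Y}
  let t : Set (Ω →₁[P] ℝ) := {Y | ∃ X ∈ G, ∃ hX : Integrable X P, Y = hX.toL1 X}
  have hI : ∀ Y : Ω →₁[P] ℝ, L1.integral Y = L1.integralCLM Y := fun Y => L1.integral_eq Y
  have ha1 : 0 ≤ a - 1 := sub_nonneg.mpr ha
  have hUopen : IsOpen U :=
    isOpen_lt (continuous_const.mul continuous_norm)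
      (continuous_const.mul L1.integralCLM.continuous)
  have hUconv : Convex ℝ U := by
    intro Y hY Z hZ r s hr hs hrs
    have hn : ‖r • Y + s • Z‖ ≤ r * ‖Y‖ + s * ‖Z‖ := by
      refine (norm_add_le _ _).trans_eq ?_
      rw [norm_smul, norm_smul, Real.norm_of_nonneg hr, Real.norm_of_nonneg hs]
    change (a - 1) * ‖r • Y + s • Z‖ < (a + 1) * L1.integralCLM (r • Y + s • Z)
    rw [map_add, map_smul, map_smul, smul_eq_mul, smul_eq_mul]
    have hY' : (a - 1) * ‖Y‖ < (a + 1) * L1.integralCLM Y := hY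
    have hZ' : (a - 1) * ‖Z‖ < (a + 1) * L1.integralCLM Z := hZ
    have h1 := mul_le_mul_of_nonneg_left hn ha1
    -- Strictness comes from the `Y` term, so its weight must be positive.
    rcases hr.eq_or_lt with rfl | hr
    · obtain rfl : s = 1 := by linarith
      linarith
    · have h2 := mul_lt_mul_of_pos_left hY' hr
      have h3 := mul_le_mul_of_nonneg_left hZ'.le hs
      linarith
  have htconv : Convex ℝ t := by
    rintro _ ⟨X, hXG, hX, rfl⟩ _ ⟨Y, hYG, hY, rfl⟩ r s hr hs -
    exact ⟨r • X + s • Y, hGadd _ (hGsmul r hr X hXG) _ (hGsmul s hs Y hYG),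
      (hX.smul r).add (hY.smul s), rfl⟩
  have hdisj : Disjoint U t := by
    rw [Set.disjoint_left]
    rintro _ hYU ⟨X, hXG, hX, rfl⟩
    refine absurd (hG X hXG) (not_le.mpr ?_)
    have h1 : (a - 1) * ‖hX.toL1 X‖ < (a + 1) * L1.integralCLM (hX.toL1 X) := hYU
    rw [← hI, ← integral_eq X hX, L1.norm_of_fun_eq_integral_norm] at h1
    exact h1
  obtain ⟨f, u, hfU, hft⟩ := geometric_hahn_banach_open hUconv hUopen htconv hdisj
  have hu : u ≤ 0 := by
    have := hft _ ⟨0, hG0, integrable_zero _ _ _, rfl⟩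
    rwa [show (integrable_zero Ω ℝ P).toL1 (0 : Ω → ℝ) = 0 from rfl, map_zero] at this
  set e : Ω →₁[P] ℝ := indicatorConstLp 1 .univ (measure_ne_top P _) 1 with he
  have hen : ‖e‖ = 1 := by
    rw [he, norm_indicatorConstLp one_ne_zero ENNReal.one_ne_top]
    simp
  have heI : L1.integralCLM e = 1 := by
    rw [← hI, L1.integral_eq_integral, integral_indicatorConstLp]
    simp
  refine ⟨-f, ?_, ?_, ?_⟩
  · have : e ∈ U := by
      change (a - 1) * ‖e‖ < (a + 1) * L1.integralCLM e
      rw [hen, heI]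
      linarith
    have := hfU e this
    simp only [neg_apply]
    linarith
  · intro Y hY
    rw [hI] at hY
    -- The closed cone is reached by pushing `Y` into `U` along the constant function: this adds at
    -- most `(a - 1) ε` on the left and exactly `(a + 1) ε` on the right.
    have h : ∀ ε : ℝ, 0 < ε → f Y + ε * f e ≤ 0 := by
      intro ε hε
      have hmem : Y + ε • e ∈ U := by
        change (a - 1) * ‖Y + ε • e‖ < (a + 1) * L1.integralCLM (Y + ε • e)
        have h1 : ‖Y + ε • e‖ ≤ ‖Y‖ + ε := by
          refine (norm_add_le _ _).trans_eq ?_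
          rw [norm_smul, hen, mul_one, Real.norm_of_nonneg hε.le]
        have h2 := mul_le_mul_of_nonneg_left h1 ha1
        rw [map_add, map_smul, heI, smul_eq_mul, mul_one]
        linarith
      have := hfU _ hmem
      rw [map_add, map_smul, smul_eq_mul] at this
      linarith
    have hlim : Tendsto (fun ε : ℝ => f Y + ε * f e) (𝓝[>] 0) (𝓝 (f Y + 0 * f e)) :=
      ((continuous_const.add (continuous_id.mul continuous_const)).tendsto 0).mono_left
        nhdsWithin_le_nhds
    have := le_of_tendsto hlim (eventually_nhdsWithin_of_forall h)
    simp only [neg_apply]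
    linarith
  · intro X hX hXG
    simp only [neg_apply, neg_nonpos]
    by_contra! hneg
    -- `f` is bounded below by `u` on the cone; a negative value could be rescaled to `u - 1`.
    have hc : 0 ≤ (u - 1) / f (hX.toL1 X) := div_nonneg_of_nonpos (by linarith) hneg.le
    have := hft _ ⟨((u - 1) / f (hX.toL1 X)) • X, hGsmul _ hc X hXG, hX.smul _, rfl⟩
    rw [Integrable.toL1_smul' X hX, map_smul, smul_eq_mul, div_mul_cancel₀ _ hneg.ne] at this
    linarith

/-- If `(a + 1) E[X] ≤ (a - 1) E|X|` on a convex cone, then some probability measure whose density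
oscillates by a factor at most `a` is nonpositive on this cone. -/
theorem exists_measure_of_cone {a : ℝ} (ha : 1 ≤ a) {G : Set (Ω → ℝ)}
    (hGint : ∀ X ∈ G, Integrable X P) (hG0 : 0 ∈ G) (hGadd : ∀ X ∈ G, ∀ Y ∈ G, X + Y ∈ G)
    (hGsmul : ∀ c : ℝ, 0 ≤ c → ∀ X ∈ G, c • X ∈ G)
    (hG : ∀ X ∈ G, (a + 1) * ∫ ω, X ω ∂P ≤ (a - 1) * ∫ ω, |X ω| ∂P) :
    ∃ Q : Measure Ω, IsProbabilityMeasure Q ∧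
      (∀ A C, MeasurableSet A → MeasurableSet C → Q A * P C ≤ ENNReal.ofReal a * (P A * Q C)) ∧
      ∀ X ∈ G, ∫ ω, X ω ∂Q ≤ 0 := by
  obtain ⟨f, hf1, hfpos, hfG⟩ := exists_functional_of_cone ha hG0 hGadd hGsmul hG
  have ha0 : 0 ≤ a := zero_le_one.trans ha
  let e : ∀ A, MeasurableSet A → (Ω →₁[P] ℝ) := fun A hA =>
    indicatorConstLp 1 hA (measure_ne_top P A) 1
  have hen : ∀ A hA, ‖e A hA‖ = P.real A := fun A hA => by
    simp [e, norm_indicatorConstLp one_ne_zero ENNReal.one_ne_top]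
  have heI : ∀ A hA, L1.integral (e A hA) = P.real A := fun A hA => by
    rw [L1.integral_eq_integral, integral_indicatorConstLp]
    simp
  obtain ⟨ν, _, hνA, hνX⟩ := exists_measure_of_positive_functional f fun A hA => by
    refine hfpos (e A hA) ?_
    rw [hen, heI]
    exact mul_le_mul_of_nonneg_right (by linarith) measureReal_nonneg
  have hν0 : ν ≠ 0 := by
    rintro rfl
    rw [hνA _ .univ] at hf1
    simp at hf1
  have hratio : ∀ A C, MeasurableSet A → MeasurableSet C →
      ν.real A * P.real C ≤ a * (P.real A * ν.real C) := by
    intro A C hA hC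
    -- The test direction lies in the closed cone: its norm is at most `(a + 1) P(A) P(C)` and its
    -- integral is `(a - 1) P(A) P(C)`.
    have h := hfpos ((a * P.real A) • e C hC - P.real C • e A hA) ?_
    · rw [map_sub, map_smul, map_smul, hνA, hνA, smul_eq_mul, smul_eq_mul] at h
      linarith
    · have h1 : ‖(a * P.real A) • e C hC - P.real C • e A hA‖ ≤ (a + 1) * (P.real A * P.real C) := by
        refine (norm_sub_le _ _).trans_eq ?_
        rw [norm_smul, norm_smul, hen, hen, Real.norm_of_nonneg measureReal_nonneg,
          Real.norm_of_nonneg (mul_nonneg ha0 measureReal_nonneg)]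
        ring
      have h2 := mul_le_mul_of_nonneg_left h1 (sub_nonneg.mpr ha)
      rw [L1.integral_sub, L1.integral_smul, L1.integral_smul, heI, heI, smul_eq_mul, smul_eq_mul]
      refine h2.trans_eq ?_
      ring
  have hfin : (ν Set.univ)⁻¹ ≠ ∞ := by simpa using hν0
  refine ⟨(ν Set.univ)⁻¹ • ν, ⟨?_⟩, ?_, ?_⟩
  · rw [Measure.smul_apply, smul_eq_mul,
      ENNReal.inv_mul_cancel (by simpa using hν0) (measure_ne_top _ _)]
  · intro A C hA hC
    have h := ENNReal.ofReal_le_ofReal (hratio A C hA hC)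
    rw [ENNReal.ofReal_mul measureReal_nonneg, ENNReal.ofReal_mul ha0,
      ENNReal.ofReal_mul measureReal_nonneg, ofReal_measureReal, ofReal_measureReal,
      ofReal_measureReal, ofReal_measureReal] at h
    rw [Measure.smul_apply, Measure.smul_apply, smul_eq_mul, smul_eq_mul]
    calc _ = (ν Set.univ)⁻¹ * (ν A * P C) := by ring
      _ ≤ (ν Set.univ)⁻¹ * (ENNReal.ofReal a * (P A * ν C)) := by gcongr
      _ = _ := by ring
  · intro X hX
    rw [integral_smul_measure, smul_eq_mul, ← hνX X (hGint X hX)]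
    exact mul_nonpos_of_nonneg_of_nonpos ENNReal.toReal_nonneg (hfG X _ hX)

end

/-! ### Oscillation of densities and gain-loss ratios. -/

section

variable {Ω : Type*} [MeasurableSpace Ω] {P Q : Measure Ω}

/-- The density of `Q` with respect to `P` oscillates by a factor at most `r`, expressed without
densities. -/
def OscillationLE (P Q : Measure Ω) (r : ℝ≥0∞) : Prop :=
  ∀ A C, MeasurableSet A → MeasurableSet C → Q A * P C ≤ r * (P A * Q C)

theorem OscillationLE.mono {r s : ℝ≥0∞} (h : OscillationLE P Q r) (hrs : r ≤ s) :
    OscillationLE P Q s :=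
  fun A C hA hC => (h A C hA hC).trans (by gcongr)

/-- For fixed `A` and `C` the defining inequality is linear in `Q`. -/
theorem OscillationLE.add {Q' : Measure Ω} {r : ℝ≥0∞} (h : OscillationLE P Q r)
    (h' : OscillationLE P Q' r) (c c' : ℝ≥0∞) : OscillationLE P (c • Q + c' • Q') r := by
  intro A C hA hC
  simp only [Measure.add_apply, Measure.smul_apply, smul_eq_mul]
  calc (c * Q A + c' * Q' A) * P C = c * (Q A * P C) + c' * (Q' A * P C) := by ring
    _ ≤ c * (r * (P A * Q C)) + c' * (r * (P A * Q' C)) :=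
      add_le_add (mul_le_mul_right (h A C hA hC) c) (mul_le_mul_right (h' A C hA hC) c')
    _ = r * (P A * (c * Q C + c' * Q' C)) := by ring

theorem lintegral_ofReal_pos_part {X : Ω → ℝ} (hX : Integrable X P) :
    ∫⁻ ω, ENNReal.ofReal (X ω) ∂P = ENNReal.ofReal ((∫ ω, |X ω| ∂P + ∫ ω, X ω ∂P) / 2) := by
  have h2 : Integrable (fun ω => (|X ω| + X ω) / 2) P := (hX.abs.add hX).div_const 2
  rw [← integral_add hX.abs hX, ← integral_div, ofReal_integral_eq_lintegral_ofReal h2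
    (.of_forall fun ω => by
      have := neg_abs_le (X ω)
      simp only [Pi.zero_apply]
      linarith)]
  refine lintegral_congr fun ω => ?_
  rcases le_total 0 (X ω) with h | h
  · rw [abs_of_nonneg h]
    ring_nf
  · rw [abs_of_nonpos h, ENNReal.ofReal_of_nonpos h]
    simp

theorem lintegral_ofReal_neg_part {X : Ω → ℝ} (hX : Integrable X P) :
    ∫⁻ ω, ENNReal.ofReal (-X ω) ∂P = ENNReal.ofReal ((∫ ω, |X ω| ∂P - ∫ ω, X ω ∂P) / 2) := by
  simpa [integral_neg, sub_eq_add_neg] using lintegral_ofReal_pos_part hX.neg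

theorem integral_le_integral_abs {X : Ω → ℝ} : ∫ ω, X ω ∂P ≤ ∫ ω, |X ω| ∂P :=
  (le_abs_self _).trans (by simpa using norm_integral_le_integral_norm (μ := P) X)

theorem abs_add_le_of_gainLoss_le {X : Ω → ℝ} (hX : Integrable X P) {a : ℝ} (ha : 0 ≤ a)
    (h : gainLoss P X ≤ ENNReal.ofReal a) :
    ∫ ω, |X ω| ∂P + ∫ ω, X ω ∂P ≤ a * (∫ ω, |X ω| ∂P - ∫ ω, X ω ∂P) := by
  have hle := integral_le_integral_abs (P := P) (X := X)
  rw [gainLoss, lintegral_ofReal_pos_part hX, lintegral_ofReal_neg_part hX] at h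
  rw [ENNReal.div_le_iff_le_mul (Or.inr ENNReal.ofReal_ne_top) (Or.inl ENNReal.ofReal_ne_top),
    ← ENNReal.ofReal_mul ha, ENNReal.ofReal_le_ofReal_iff (mul_nonneg ha (by linarith))] at h
  linarith

variable [IsProbabilityMeasure P]

theorem essSup_rnDeriv_le [SigmaFinite Q] {c : ℝ≥0∞} (h : Q ≤ c • P) : essSup (Q.rnDeriv P) P ≤ c := by
  refine essSup_le_of_ae_le _ (ae_le_of_forall_setLIntegral_le_of_sigmaFinite₀
    (Measure.measurable_rnDeriv _ _).aemeasurable fun A hA _ => ?_)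
  rw [setLIntegral_const]
  exact (Measure.setLIntegral_rnDeriv_le A).trans (h A)

theorem le_essInf_rnDeriv [SigmaFinite Q] (hQ : Q ≪ P) {c : ℝ≥0∞} (h : c • P ≤ Q) :
    c ≤ essInf (Q.rnDeriv P) P := by
  refine le_essInf_of_ae_le _ (ae_le_of_forall_setLIntegral_le_of_sigmaFinite₀
    aemeasurable_const fun A hA _ => ?_)
  rw [setLIntegral_const, Measure.setLIntegral_rnDeriv hQ]
  exact h A

theorem le_essSup_rnDeriv_smul [SigmaFinite Q] (hQ : Q ≪ P) :
    Q ≤ essSup (Q.rnDeriv P) P • P := by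
  conv_lhs => rw [← Measure.withDensity_rnDeriv_eq Q P hQ]
  rw [← withDensity_const]
  exact withDensity_mono (ENNReal.ae_le_essSup _)

theorem essInf_rnDeriv_smul_le [SigmaFinite Q] (hQ : Q ≪ P) :
    essInf (Q.rnDeriv P) P • P ≤ Q := by
  conv_rhs => rw [← Measure.withDensity_rnDeriv_eq Q P hQ]
  rw [← withDensity_const]
  exact withDensity_mono ae_essInf_le

theorem essInf_rnDeriv_ne_top [IsFiniteMeasure Q] (hQ : Q ≪ P) :
    essInf (Q.rnDeriv P) P ≠ ∞ := by
  have h := essInf_rnDeriv_smul_le hQ Set.univ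
  rw [Measure.smul_apply, measure_univ, smul_eq_mul, mul_one] at h
  exact (h.trans_lt (measure_lt_top _ _)).ne

theorem gainLoss_le_densityRatio [IsFiniteMeasure Q] (hQ : Q ≪ P)
    (hM : essSup (Q.rnDeriv P) P < ∞) (hm : 0 < essInf (Q.rnDeriv P) P) {X : Ω → ℝ}
    (hX : Integrable X P) (hX0 : ¬ X =ᵐ[P] 0) (hXQ : ∫ ω, X ω ∂Q ≤ 0) :
    gainLoss P X ≤ densityRatio P Q := by
  have hle := le_essSup_rnDeriv_smul hQ
  have hge := essInf_rnDeriv_smul_le hQ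
  have hmt := essInf_rnDeriv_ne_top hQ
  rw [gainLoss, densityRatio]
  set M := essSup (Q.rnDeriv P) P
  set m := essInf (Q.rnDeriv P) P
  have hXiQ : Integrable X Q := (hX.smul_measure hM.ne).mono_measure hle
  have hQX : ∫⁻ ω, ENNReal.ofReal (X ω) ∂Q ≤ ∫⁻ ω, ENNReal.ofReal (-X ω) ∂Q := by
    rw [lintegral_ofReal_pos_part hXiQ, lintegral_ofReal_neg_part hXiQ]
    exact ENNReal.ofReal_le_ofReal (by linarith)
  have key : m * ∫⁻ ω, ENNReal.ofReal (X ω) ∂P ≤ M * ∫⁻ ω, ENNReal.ofReal (-X ω) ∂P := by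
    rw [← smul_eq_mul, ← smul_eq_mul, ← lintegral_smul_measure, ← lintegral_smul_measure]
    exact (lintegral_mono' hge le_rfl).trans (hQX.trans (lintegral_mono' hle le_rfl))
  -- Without losses, `key` would exclude gains as well, making `X` vanish almost surely.
  have hn : ∫⁻ ω, ENNReal.ofReal (-X ω) ∂P ≠ 0 := by
    intro h0
    rw [h0, mul_zero, nonpos_iff_eq_zero, mul_eq_zero, or_iff_right hm.ne'] at key
    rw [lintegral_eq_zero_iff' hX.1.aemeasurable.ennreal_ofReal] at key
    have hneg : AEMeasurable (fun ω => ENNReal.ofReal (-X ω)) P :=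
      hX.1.aemeasurable.neg.ennreal_ofReal
    rw [lintegral_eq_zero_iff' hneg] at h0
    refine hX0 ?_
    filter_upwards [key, h0] with ω h1 h2
    simp only [Pi.zero_apply, ENNReal.ofReal_eq_zero] at h1 h2 ⊢
    linarith
  have hnt : ∫⁻ ω, ENNReal.ofReal (-X ω) ∂P ≠ ∞ := by
    rw [lintegral_ofReal_neg_part hX]
    exact ENNReal.ofReal_ne_top
  rw [ENNReal.div_le_iff hn hnt, ENNReal.mul_comm_div, ← mul_div_assoc,
    ENNReal.le_div_iff_mul_le (Or.inl hm.ne') (Or.inl hmt), mul_comm]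
  exact key

variable [IsProbabilityMeasure Q] {r : ℝ≥0∞}

theorem OscillationLE.le_smul (h : OscillationLE P Q r) : Q ≤ r • P :=
  Measure.le_iff.mpr fun A hA => by simpa using h A Set.univ hA .univ

theorem OscillationLE.le_smul' (h : OscillationLE P Q r) : P ≤ r • Q :=
  Measure.le_iff.mpr fun A hA => by simpa using h Set.univ A .univ hA

theorem OscillationLE.absolutelyContinuous (h : OscillationLE P Q r) : Q ≪ P :=
  (Measure.absolutelyContinuous_of_le h.le_smul).trans Measure.smul_absolutelyContinuous

theorem OscillationLE.absolutelyContinuous' (h : OscillationLE P Q r) : P ≪ Q :=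
  (Measure.absolutelyContinuous_of_le h.le_smul').trans Measure.smul_absolutelyContinuous

theorem OscillationLE.one_le (h : OscillationLE P Q r) : 1 ≤ r := by
  simpa using h Set.univ Set.univ .univ .univ

theorem OscillationLE.essInf_pos (h : OscillationLE P Q r) (hr : r ≠ ∞) :
    0 < essInf (Q.rnDeriv P) P := by
  have hr0 : r ≠ 0 := (zero_lt_one.trans_le h.one_le).ne'
  refine (ENNReal.inv_pos.mpr hr).trans_le (le_essInf_rnDeriv h.absolutelyContinuous ?_)
  refine Measure.le_iff.mpr fun A _ => ?_
  rw [Measure.smul_apply, smul_eq_mul, mul_comm, ← div_eq_mul_inv, ENNReal.div_le_iff hr0 hr,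
    mul_comm]
  exact h.le_smul' A

theorem OscillationLE.densityRatio_le (h : OscillationLE P Q r) (hr : r ≠ ∞) :
    densityRatio P Q ≤ r := by
  have hr0 : r ≠ 0 := (zero_lt_one.trans_le h.one_le).ne'
  -- For fixed `C`, letting `A` vary bounds the essential supremum by `r Q(C) / P(C)`; letting `C`
  -- vary afterwards bounds the essential infimum from below.
  have hM : ∀ C, MeasurableSet C → essSup (Q.rnDeriv P) P * P C ≤ r * Q C := by
    intro C hC
    rcases eq_or_ne (P C) 0 with h0 | h0
    · simp [h0]
    · rw [← ENNReal.le_div_iff_mul_le (Or.inl h0) (Or.inl (measure_ne_top _ _))]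
      refine essSup_rnDeriv_le (Measure.le_iff.mpr fun A hA => ?_)
      rw [Measure.smul_apply, smul_eq_mul, mul_comm, ← mul_div_assoc,
        ENNReal.le_div_iff_mul_le (Or.inl h0) (Or.inl (measure_ne_top _ _))]
      exact (h A C hA hC).trans_eq (by ring)
  refine ENNReal.div_le_of_le_mul' ?_
  rw [← ENNReal.div_le_iff hr0 hr]
  refine le_essInf_rnDeriv h.absolutelyContinuous (Measure.le_iff.mpr fun C hC => ?_)
  rw [Measure.smul_apply, smul_eq_mul, mul_comm, ← mul_div_assoc, ENNReal.div_le_iff hr0 hr,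
    mul_comm, mul_comm (Q C)]
  exact hM C hC

end

/-! ### Duality for the best gain-loss ratio. -/

section

variable {Ω : Type*} [mΩ : MeasurableSpace Ω] {P Q : Measure Ω}
  {T : ℝ} {𝓕 : Filtration (Set.Icc (0 : ℝ) T) mΩ} {d : ℕ}
  {S : Set.Icc (0 : ℝ) T → Ω → EuclideanSpace ℝ (Fin d)} {B : Ω → ℝ}

theorem densityRatio_lt_top (hQ : Q ∈ boundedMartingaleMeasures P 𝓕 S) : densityRatio P Q < ∞ :=
  ENNReal.div_lt_top hQ.2.2.2.2.1.ne hQ.2.2.2.2.2.ne'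

/-- A finite best gain-loss ratio of `B` bounds the gain-loss ratio of each `s B + K`, `s ≥ 0`. -/
theorem abs_add_le_of_bestGainLoss_lt_top (hT : 0 < T) (hS : StronglyAdapted 𝓕 S)
    (hc : IsCadlag S) (hmax : IntegrableMaximal P S) (hB : Integrable B P)
    (hfin : bestGainLoss P 𝓕 S B < ∞) {K : Ω → ℝ} (hK : K ∈ gains 𝓕 S) {s : ℝ} (hs : 0 ≤ s) :
    ∫ ω, |(s • B + K) ω| ∂P + ∫ ω, (s • B + K) ω ∂P ≤ (bestGainLoss P 𝓕 S B).toReal *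
      (∫ ω, |(s • B + K) ω| ∂P - ∫ ω, (s • B + K) ω ∂P) := by
  set a := (bestGainLoss P 𝓕 S B).toReal with ha_def
  have ha : 0 ≤ a := ENNReal.toReal_nonneg
  have hgen : ∀ K ∈ gains 𝓕 S, ∫ ω, |(B + K) ω| ∂P + ∫ ω, (B + K) ω ∂P ≤
      a * (∫ ω, |(B + K) ω| ∂P - ∫ ω, (B + K) ω ∂P) := by
    intro K hK
    by_cases h0 : B + K =ᵐ[P] 0
    · have h1 : (fun ω => |(B + K) ω|) =ᵐ[P] 0 := by
        filter_upwards [h0] with ω hω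
        simp [hω]
      rw [integral_congr_ae h0, integral_congr_ae h1]
      simp
    · refine abs_add_le_of_gainLoss_le (hB.add (gain_integrable hT hS hc hmax hK)) ha ?_
      rw [ha_def, ENNReal.ofReal_toReal hfin.ne]
      exact le_iSup₂_of_le K hK (le_iSup_of_le h0 le_rfl)
  -- The inequality is homogeneous and `K / s` is again a gain.
  have hpos : ∀ s : ℝ, 0 < s → ∫ ω, |(s • B + K) ω| ∂P + ∫ ω, (s • B + K) ω ∂P ≤
      a * (∫ ω, |(s • B + K) ω| ∂P - ∫ ω, (s • B + K) ω ∂P) := by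
    intro s hs
    have h := hgen _ (smul_mem_gains hK s⁻¹)
    have heq : s • B + K = s • (B + s⁻¹ • K) := by
      rw [smul_add, smul_inv_smul₀ hs.ne']
    have h1 : ∫ ω, (s • B + K) ω ∂P = s * ∫ ω, (B + s⁻¹ • K) ω ∂P := by
      rw [heq, ← integral_const_mul]
      rfl
    have h2 : ∫ ω, |(s • B + K) ω| ∂P = s * ∫ ω, |(B + s⁻¹ • K) ω| ∂P := by
      rw [heq, ← integral_const_mul]
      refine integral_congr_ae (.of_forall fun ω => ?_)
      simp only [Pi.smul_apply, smul_eq_mul, abs_mul, abs_of_pos hs]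
    rw [h1, h2]
    have := mul_le_mul_of_nonneg_left h hs.le
    linarith
  -- The case `s = 0` is the limit of `ε B + K` as `ε ↓ 0`.
  rcases hs.eq_or_lt with rfl | hs
  · have hKint := gain_integrable hT hS hc hmax hK
    have hlim : ∀ c : ℝ, Tendsto (fun ε : ℝ => c * ε) (𝓝[>] 0) (𝓝 0) := fun c => by
      simpa using ((continuous_const_mul c).tendsto (0 : ℝ)).mono_left
        (nhdsWithin_le_nhds (s := Set.Ioi 0))
    have hdiff : ∀ ε : ℝ, 0 < ε → |∫ ω, |(ε • B + K) ω| ∂P - ∫ ω, |K ω| ∂P| ≤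
        (∫ ω, |B ω| ∂P) * ε := by
      intro ε hε
      rw [← integral_sub ((hB.smul ε).add hKint).abs hKint.abs, ← integral_mul_const,
        ← Real.norm_eq_abs]
      refine norm_integral_le_of_norm_le (hB.abs.mul_const ε) (.of_forall fun ω => ?_)
      rw [Real.norm_eq_abs]
      refine (abs_abs_sub_abs_le _ _).trans_eq ?_
      simp [abs_mul, abs_of_pos hε, mul_comm]
    have h1 : Tendsto (fun ε : ℝ => ∫ ω, |(ε • B + K) ω| ∂P) (𝓝[>] 0) (𝓝 (∫ ω, |K ω| ∂P)) := by
      rw [tendsto_iff_norm_sub_tendsto_zero]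
      exact squeeze_zero' (.of_forall fun _ => norm_nonneg _)
        (eventually_nhdsWithin_of_forall hdiff) (hlim _)
    have h2 : Tendsto (fun ε : ℝ => ∫ ω, (ε • B + K) ω ∂P) (𝓝[>] 0) (𝓝 (∫ ω, K ω ∂P)) := by
      have heq : ∀ ε : ℝ, ∫ ω, (ε • B + K) ω ∂P = (∫ ω, B ω ∂P) * ε + ∫ ω, K ω ∂P := by
        intro ε
        rw [← integral_mul_const, ← integral_add (hB.mul_const ε) hKint]
        refine integral_congr_ae (.of_forall fun ω => ?_)
        simp [mul_comm]
      simp only [heq]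
      simpa using (hlim (∫ ω, B ω ∂P)).add_const (∫ ω, K ω ∂P)
    have := le_of_tendsto_of_tendsto (h1.add h2) ((h1.sub h2).const_mul a)
      (eventually_nhdsWithin_of_forall hpos)
    simpa using this
  · exact hpos s hs

/-- Adding the inequalities for `K` and `-K` gives `2 E|K| ≤ 2 a E|K|`, with `E|K| > 0` for a
nontrivial gain. The bound `1 ≤ a` is what makes the cone to be separated convex. -/
theorem one_le_bestGainLoss (hT : 0 < T) (hS : StronglyAdapted 𝓕 S)
    (hc : IsCadlag S) (hmax : IntegrableMaximal P S)
    (hnontriv : ∃ K ∈ gains 𝓕 S, ¬ (K =ᵐ[P] 0)) (hB : Integrable B P)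
    (hfin : bestGainLoss P 𝓕 S B < ∞) : 1 ≤ (bestGainLoss P 𝓕 S B).toReal := by
  obtain ⟨K, hK, hK0⟩ := hnontriv
  have hKint := gain_integrable hT hS hc hmax hK
  have h1 := abs_add_le_of_bestGainLoss_lt_top hT hS hc hmax hB hfin hK le_rfl
  have h2 := abs_add_le_of_bestGainLoss_lt_top hT hS hc hmax hB hfin (smul_mem_gains hK (-1)) le_rfl
  simp only [zero_smul, zero_add, neg_one_smul, Pi.neg_apply, abs_neg, integral_neg] at h1 h2
  have hpos : 0 < ∫ ω, |K ω| ∂P := by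
    refine (integral_nonneg fun ω => abs_nonneg (K ω)).lt_of_ne' fun h => hK0 ?_
    rw [integral_eq_zero_iff_of_nonneg (fun ω => abs_nonneg (K ω)) hKint.abs] at h
    filter_upwards [h] with ω hω
    simpa using hω
  nlinarith

variable [IsProbabilityMeasure P]

theorem OscillationLE.mem_boundedMartingaleMeasures [IsProbabilityMeasure Q] {r : ℝ≥0∞}
    (h : OscillationLE P Q r) (hr : r ≠ ∞) (hS : StronglyAdapted 𝓕 S)
    (hint : ∀ t, Integrable (S t) P) (hK : ∀ K ∈ gains 𝓕 S, ∫ ω, K ω ∂Q = 0) :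
    Q ∈ boundedMartingaleMeasures P 𝓕 S :=
  ⟨inferInstance, h.absolutelyContinuous, h.absolutelyContinuous',
    martingale_of_integral_gain_eq_zero hS
      (fun t => ((hint t).smul_measure hr).mono_measure h.le_smul) hK,
    (essSup_rnDeriv_le h.le_smul).trans_lt hr.lt_top, h.essInf_pos hr⟩

theorem integral_gain_of_mem_boundedMartingaleMeasures (hT : 0 < T) (hc : IsCadlag S)
    (hmax : IntegrableMaximal P S) (hQ : Q ∈ boundedMartingaleMeasures P 𝓕 S) {K : Ω → ℝ}
    (hK : K ∈ gains 𝓕 S) : ∫ ω, K ω ∂Q = 0 := by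
  obtain ⟨hprob, hQP, -, hM, hsup, -⟩ := hQ
  exact integral_gain_of_martingale hT hc
    (hmax.of_le_smul hsup.ne (le_essSup_rnDeriv_smul hQP)) hM hK

theorem bestGainLoss_le_densityRatio (hT : 0 < T) (hS : StronglyAdapted 𝓕 S) (hc : IsCadlag S)
    (hmax : IntegrableMaximal P S) (hB : Integrable B P)
    (hQ : Q ∈ boundedMartingaleMeasures P 𝓕 S) (hBQ : ∫ ω, B ω ∂Q ≤ 0) :
    bestGainLoss P 𝓕 S B ≤ densityRatio P Q := by
  refine iSup₂_le fun K hK => iSup_le fun hne => ?_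
  have hK0 := integral_gain_of_mem_boundedMartingaleMeasures hT hc hmax hQ hK
  obtain ⟨hprob, hQP, -, -, hsup, hinf⟩ := hQ
  have hKint := gain_integrable hT hS hc hmax hK
  have hle := le_essSup_rnDeriv_smul hQP
  refine gainLoss_le_densityRatio hQP hsup hinf (hB.add hKint) hne ?_
  have h := integral_add ((hB.smul_measure hsup.ne).mono_measure hle)
    ((hKint.smul_measure hsup.ne).mono_measure hle)
  rw [hK0, add_zero] at h
  exact h.trans_le hBQ

/-- **Duality**: a finite best gain-loss ratio is an oscillation bound for the density of some
measure that annihilates the gains and is nonpositive on the claim. -/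
theorem exists_measure_of_bestGainLoss_lt_top (hT : 0 < T) (hS : StronglyAdapted 𝓕 S)
    (hc : IsCadlag S) (hmax : IntegrableMaximal P S)
    (hnontriv : ∃ K ∈ gains 𝓕 S, ¬ (K =ᵐ[P] 0)) (hB : Integrable B P)
    (hfin : bestGainLoss P 𝓕 S B < ∞) :
    ∃ Q : Measure Ω, IsProbabilityMeasure Q ∧ OscillationLE P Q (bestGainLoss P 𝓕 S B) ∧
      (∀ K ∈ gains 𝓕 S, ∫ ω, K ω ∂Q = 0) ∧ ∫ ω, B ω ∂Q ≤ 0 := by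
  have hone := one_le_bestGainLoss hT hS hc hmax hnontriv hB hfin
  have h0 : (0 : Ω → ℝ) ∈ gains 𝓕 S := by
    obtain ⟨K, hK, -⟩ := hnontriv
    simpa using smul_mem_gains hK 0
  -- Only nonnegative multiples of `B` are allowed, so `B` ends up nonpositive, whereas `K` and `-K`
  -- both belong to the cone.
  let G : Set (Ω → ℝ) := {X | ∃ s : ℝ, 0 ≤ s ∧ ∃ K ∈ gains 𝓕 S, X = s • B + K}
  have hGint : ∀ X ∈ G, Integrable X P := by
    rintro _ ⟨s, -, K, hK, rfl⟩
    exact (hB.smul s).add (gain_integrable hT hS hc hmax hK)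
  have hGadd : ∀ X ∈ G, ∀ Y ∈ G, X + Y ∈ G := by
    rintro _ ⟨s, hs, K, hK, rfl⟩ _ ⟨t, ht, L, hL, rfl⟩
    exact ⟨s + t, add_nonneg hs ht, K + L, add_mem_gains hK hL, by rw [add_smul]; abel⟩
  have hGsmul : ∀ c : ℝ, 0 ≤ c → ∀ X ∈ G, c • X ∈ G := by
    rintro c hc' _ ⟨s, hs, K, hK, rfl⟩
    exact ⟨c * s, mul_nonneg hc' hs, c • K, smul_mem_gains hK c, by rw [smul_add, mul_smul]⟩
  obtain ⟨Q, hQ, hosc, hle⟩ := exists_measure_of_cone hone hGint ⟨0, le_rfl, 0, h0, by simp⟩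
    hGadd hGsmul (by
      rintro _ ⟨s, hs, K, hK, rfl⟩
      have := abs_add_le_of_bestGainLoss_lt_top hT hS hc hmax hB hfin hK hs
      linarith)
  rw [ENNReal.ofReal_toReal hfin.ne] at hosc
  refine ⟨Q, hQ, hosc, fun K hK => le_antisymm (hle K ⟨0, le_rfl, K, hK, by simp⟩) ?_,
    hle B ⟨1, zero_le_one, 0, h0, by simp⟩⟩
  have h := hle ((-1 : ℝ) • K) ⟨0, le_rfl, _, smul_mem_gains hK (-1), by simp⟩
  simpa [integral_neg] using h

/-- If the claim has a larger best gain-loss ratio than `0`, then the dual measure can be chosen so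
that the claim has zero expectation. -/
theorem exists_measure_integral_eq_zero (hT : 0 < T) (hS : StronglyAdapted 𝓕 S)
    (hc : IsCadlag S) (hmax : IntegrableMaximal P S) (hint : ∀ t, Integrable (S t) P)
    (hnontriv : ∃ K ∈ gains 𝓕 S, ¬ (K =ᵐ[P] 0)) (hB : Integrable B P)
    (hlt : bestGainLoss P 𝓕 S 0 < bestGainLoss P 𝓕 S B) (hfin : bestGainLoss P 𝓕 S B < ∞) :
    ∃ Q : Measure Ω, IsProbabilityMeasure Q ∧ OscillationLE P Q (bestGainLoss P 𝓕 S B) ∧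
      (∀ K ∈ gains 𝓕 S, ∫ ω, K ω ∂Q = 0) ∧ ∫ ω, B ω ∂Q = 0 := by
  obtain ⟨Q, hQ, hosc, hK, hBQ⟩ :=
    exists_measure_of_bestGainLoss_lt_top hT hS hc hmax hnontriv hB hfin
  obtain ⟨Q₀, hQ₀, hosc₀, hK₀, -⟩ :=
    exists_measure_of_bestGainLoss_lt_top hT hS hc hmax hnontriv (integrable_zero Ω ℝ P)
      (hlt.trans hfin)
  -- Otherwise `Q₀` would be admissible for `B`, and weak duality would give `α*(B) ≤ α*(0)`.
  have hBQ₀ : 0 < ∫ ω, B ω ∂Q₀ := by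
    by_contra! h
    refine absurd hlt (not_lt.mpr ?_)
    exact (bestGainLoss_le_densityRatio hT hS hc hmax hB
      (hosc₀.mem_boundedMartingaleMeasures (hlt.trans hfin).ne hS hint hK₀) h).trans
      (hosc₀.densityRatio_le (hlt.trans hfin).ne)
  have hintQ : ∀ {X : Ω → ℝ}, Integrable X P → Integrable X Q := fun hX =>
    (hX.smul_measure hfin.ne).mono_measure hosc.le_smul
  have hint₀ : ∀ {X : Ω → ℝ}, Integrable X P → Integrable X Q₀ := fun hX =>
    (hX.smul_measure (hlt.trans hfin).ne).mono_measure hosc₀.le_smul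
  set b := ∫ ω, B ω ∂Q
  set c := ∫ ω, B ω ∂Q₀
  have hcb : 0 < c - b := by linarith
  -- As `b ≤ 0 < c`, these are the convex weights for which the mixture gives `B` expectation `(c b
  -- - b c) / (c - b) = 0`.
  have hw1 : 0 ≤ c / (c - b) := div_nonneg hBQ₀.le hcb.le
  have hw2 : 0 ≤ -b / (c - b) := div_nonneg (by linarith) hcb.le
  have hmix : ∀ {X : Ω → ℝ}, Integrable X P →
      ∫ ω, X ω ∂(ENNReal.ofReal (c / (c - b)) • Q + ENNReal.ofReal (-b / (c - b)) • Q₀) =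
        c / (c - b) * ∫ ω, X ω ∂Q + -b / (c - b) * ∫ ω, X ω ∂Q₀ := fun hX => by
    rw [integral_add_measure ((hintQ hX).smul_measure ENNReal.ofReal_ne_top)
      ((hint₀ hX).smul_measure ENNReal.ofReal_ne_top), integral_smul_measure,
      integral_smul_measure, ENNReal.toReal_ofReal hw1, ENNReal.toReal_ofReal hw2, smul_eq_mul,
      smul_eq_mul]
  refine ⟨ENNReal.ofReal (c / (c - b)) • Q + ENNReal.ofReal (-b / (c - b)) • Q₀, ⟨?_⟩,
    hosc.add (hosc₀.mono hlt.le) _ _, fun K hKg => ?_, ?_⟩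
  · simp only [Measure.add_apply, Measure.smul_apply, measure_univ, smul_eq_mul, mul_one]
    rw [← ENNReal.ofReal_add hw1 hw2, ← add_div, ← sub_eq_add_neg, div_self hcb.ne',
      ENNReal.ofReal_one]
  · rw [hmix (gain_integrable hT hS hc hmax hKg), hK K hKg, hK₀ K hKg, mul_zero, mul_zero, add_zero]
  · rw [hmix hB]
    ring

end

end GainLoss

/-- The process `S` on the stochastic basis `(Ω, (𝓕_t)_{t ∈ [0, T]}, P)` is càdlàg, adapted, with
integrable maximal functional, and the market is not trivial: some gain is not a.s. zero. -/
theorem theorem2 {Ω : Type*} [mΩ : MeasurableSpace Ω] (P : Measure Ω) [IsProbabilityMeasure P]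
    {T : ℝ} (hT : 0 < T) (𝓕 : Filtration (Set.Icc (0 : ℝ) T) mΩ) {d : ℕ}
    (S : Set.Icc (0 : ℝ) T → Ω → EuclideanSpace ℝ (Fin d))
    (hS_adapted : StronglyAdapted 𝓕 S) (hS_cadlag : GainLoss.IsCadlag S)
    (hS_max : GainLoss.IntegrableMaximal P S)
    (h_nontrivial : ∃ K ∈ GainLoss.gains 𝓕 S, ¬ (K =ᵐ[P] 0))
    (B : Ω → ℝ) (hB : Integrable B P) :
    (GainLoss.bestGainLoss P 𝓕 S B < ∞ ↔
      ∃ Q ∈ GainLoss.boundedMartingaleMeasures P 𝓕 S, ∫ ω, B ω ∂Q ≤ 0) ∧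
    (GainLoss.bestGainLoss P 𝓕 S B < ∞ →
      IsLeast (GainLoss.densityRatio P ''
          {Q | Q ∈ GainLoss.boundedMartingaleMeasures P 𝓕 S ∧ ∫ ω, B ω ∂Q ≤ 0})
        (GainLoss.bestGainLoss P 𝓕 S B)) ∧
    (GainLoss.bestGainLoss P 𝓕 S 0 < GainLoss.bestGainLoss P 𝓕 S B →
      GainLoss.bestGainLoss P 𝓕 S B < ∞ →
      IsLeast (GainLoss.densityRatio P ''
          {Q | Q ∈ GainLoss.boundedMartingaleMeasures P 𝓕 S ∧ ∫ ω, B ω ∂Q = 0})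
        (GainLoss.bestGainLoss P 𝓕 S B)) := by
  have hint : ∀ t, Integrable (S t) P := fun t =>
    hS_max.integrable (σ := fun _ => t) ((hS_adapted t).mono (𝓕.le t))
  refine ⟨⟨fun hfin => ?_, ?_⟩, fun hfin => ⟨?_, ?_⟩, fun hlt hfin => ⟨?_, ?_⟩⟩
  · obtain ⟨Q, _, hosc, hK, hBQ⟩ := GainLoss.exists_measure_of_bestGainLoss_lt_top hT hS_adapted
      hS_cadlag hS_max h_nontrivial hB hfin
    exact ⟨Q, hosc.mem_boundedMartingaleMeasures hfin.ne hS_adapted hint hK, hBQ⟩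
  · rintro ⟨Q, hQ, hBQ⟩
    exact (GainLoss.bestGainLoss_le_densityRatio hT hS_adapted hS_cadlag hS_max hB hQ hBQ).trans_lt
      (GainLoss.densityRatio_lt_top hQ)
  · obtain ⟨Q, _, hosc, hK, hBQ⟩ := GainLoss.exists_measure_of_bestGainLoss_lt_top hT hS_adapted
      hS_cadlag hS_max h_nontrivial hB hfin
    have hQ := hosc.mem_boundedMartingaleMeasures hfin.ne hS_adapted hint hK
    exact ⟨Q, ⟨hQ, hBQ⟩, (hosc.densityRatio_le hfin.ne).antisymm
      (GainLoss.bestGainLoss_le_densityRatio hT hS_adapted hS_cadlag hS_max hB hQ hBQ)⟩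
  · rintro _ ⟨Q, ⟨hQ, hBQ⟩, rfl⟩
    exact GainLoss.bestGainLoss_le_densityRatio hT hS_adapted hS_cadlag hS_max hB hQ hBQ
  · obtain ⟨Q, _, hosc, hK, hBQ⟩ := GainLoss.exists_measure_integral_eq_zero hT hS_adapted
      hS_cadlag hS_max hint h_nontrivial hB hlt hfin
    have hQ := hosc.mem_boundedMartingaleMeasures hfin.ne hS_adapted hint hK
    exact ⟨Q, ⟨hQ, hBQ⟩, (hosc.densityRatio_le hfin.ne).antisymm
      (GainLoss.bestGainLoss_le_densityRatio hT hS_adapted hS_cadlag hS_max hB hQ hBQ.le)⟩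
  · rintro _ ⟨Q, ⟨hQ, hBQ⟩, rfl⟩
    exact GainLoss.bestGainLoss_le_densityRatio hT hS_adapted hS_cadlag hS_max hB hQ hBQ.le
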